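/- Let $\mathcal A$ be a central arrangement of $d\ge 0$ distinct planes through the origin in $\mathbb C^3$, the kernels of nonzero linear forms $\ell_1,\dots,\ell_d$. Let $[\mathcal A]\subset\mathbb P^2=\mathbb P(\mathbb C^3)$ be the image, under $v\mapsto[v]$, of the nonzero vectors lying on the planes of $\mathcal A$. A 1-flat of $\mathcal A$ is a line $L\subset\mathbb C^3$ through the origin which is the intersection of two or more planes of $\mathcal A$, and $d_L$ denotes the number of planes of $\mathcal A$ containing $L$. For a topological space $X$ let $\chi(X)=\sum_n(-1)^n\dim_{\mathbb C}H_n(X;\mathbb C)$ be its Euler characteristic (singular homology). Then $\mathbb P^2\setminus[\mathcal A]$ has finite-dimensional total homology $\bigoplus_n H_n(\,\cdot\,;\mathbb C)$, and $$\chi(\mathbb P^2\setminus[\mathcal A]) = 3-2d+\sum_L(d_L-1),$$ the sum running over the 1-flats $L$ of $\mathcal A$. Moreover, if $d\ge 1$ and $F=\{v\in\mathbb C^3:\ell_1(v)\cdots\ell_d(v)=1\}$ is the Milnor fiber of $\mathcal A$, then the map $F\to\mathbb P^2\setminus[\mathcal A]$, $v\mapsto[v]$, is a covering map all of whose fibers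 have exactly $d$ points, $F$ has finite-dimensional total homology, and $$\chi(F)=d\cdot\chi(\mathbb P^2\setminus[\mathcal A])=d\Bigl(3-2d+\sum_L(d_L-1)\Bigr).$$ -/

import Mathlib

open CategoryTheory AlgebraicTopology

noncomputable section

/-- The singular chain complex of a topological space with complex coefficients. -/
def complexSingularChains (X : Type) [TopologicalSpace X] : ChainComplex (ModuleCat.{0} ℂ) ℕ :=
  ((singularChainComplexFunctor (ModuleCat.{0} ℂ)).obj (ModuleCat.of ℂ ℂ)).obj (TopCat.of X)

/-- The total complex singular homology of `X` is finite-dimensional: every homology space is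
finite-dimensional, and all but finitely many vanish. This is what makes the Euler characteristic
of `X` meaningful. -/
def HasFiniteTotalHomology (X : Type) [TopologicalSpace X] : Prop :=
  (∀ n, Module.Finite ℂ ((complexSingularChains X).homology n)) ∧
    ∃ N, ∀ n, N ≤ n → Subsingleton ((complexSingularChains X).homology n)

/-- The topological Euler characteristic `∑ₙ (-1)ⁿ dim_ℂ Hₙ(X; ℂ)`. -/
def eulerCharacteristic (X : Type) [TopologicalSpace X] : ℤ :=
  (complexSingularChains X).homologyEulerChar

/-- The affine space `ℂ³`, with its usual (product) topology. -/
abbrev C3 : Type := Fin 3 → ℂ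

/-- The complex projective plane. -/
abbrev CP2 : Type := Projectivization ℂ C3

/-- The complex projective plane carries the quotient topology from `ℂ³ ∖ {0}`. -/
instance CP2.instTopologicalSpace : TopologicalSpace CP2 :=
  inferInstanceAs (TopologicalSpace (Quotient (projectivizationSetoid ℂ C3)))

/-- A central arrangement of `d` (distinct) planes through the origin of `ℂ³`, given by
defining linear forms. -/
structure CentralArrangement (d : ℕ) where
  /-- the defining linear forms -/
  form : Fin d → Module.Dual ℂ C3
  form_ne_zero : ∀ i, form i ≠ 0
  ker_injective : Function.Injective fun i => LinearMap.ker (form i)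

namespace CentralArrangement

variable {d : ℕ} (A : CentralArrangement d)

/-- The `i`-th plane of the arrangement. -/
def plane (i : Fin d) : Submodule ℂ C3 := LinearMap.ker (A.form i)

/-- The union of the planes of the arrangement. -/
def union : Set C3 := ⋃ i, (A.plane i : Set C3)

/-- The image in the projective plane of the union of the planes (minus the origin). -/
def projectivization : Set CP2 :=
  {p | ∃ (v : C3) (hv : v ≠ 0), v ∈ A.union ∧ p = Projectivization.mk ℂ v hv}

/-- The complement of the arrangement in the projective plane, with the subspace topology. -/
abbrev ProjComplement : Type := ↥(A.projectivizationᶜ)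

/-- The defining polynomial function: the product of the linear forms. -/
def definingFunction (v : C3) : ℂ := ∏ i, A.form i v

/-- The Milnor fiber, with the subspace topology. -/
abbrev MilnorFiber : Type := {v : C3 // A.definingFunction v = 1}

theorem form_ne_zero_of_mem (x : A.MilnorFiber) (i : Fin d) : A.form i x.1 ≠ 0 := by
  have h : ∏ i, A.form i x.1 ≠ 0 := by
    have := x.2
    unfold definingFunction at this
    rw [this]
    exact one_ne_zero
  exact Finset.prod_ne_zero_iff.1 h i (Finset.mem_univ i)

theorem ne_zero_of_mem (hd : 0 < d) (x : A.MilnorFiber) : x.1 ≠ 0 := by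
  intro h
  apply A.form_ne_zero_of_mem x ⟨0, hd⟩
  rw [h, map_zero]

theorem mk_notMem (hd : 0 < d) (x : A.MilnorFiber) :
    Projectivization.mk ℂ x.1 (A.ne_zero_of_mem hd x) ∈ A.projectivizationᶜ := by
  rintro ⟨v, hv, hmem, heq⟩
  obtain ⟨i, hi⟩ := Set.mem_iUnion.1 hmem
  obtain ⟨a, ha⟩ := (Projectivization.mk_eq_mk_iff' ℂ _ _ _ _).1 heq
  apply A.form_ne_zero_of_mem x i
  have hi' : A.form i v = 0 := hi
  rw [← ha, map_smul, hi', smul_zero]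

/-- The restriction to the Milnor fiber of the Hopf map `v ↦ [v]`, as a map to the complement of
the arrangement in the projective plane (for a nonempty arrangement). -/
def milnorProjection (hd : 0 < d) (x : A.MilnorFiber) : A.ProjComplement :=
  ⟨Projectivization.mk ℂ x.1 (A.ne_zero_of_mem hd x), A.mk_notMem hd x⟩

/-- The `1`-flats: the lines which are intersections of two or more planes of the arrangement. -/
def oneFlats : Set (Submodule ℂ C3) :=
  {L | Module.finrank ℂ L = 1 ∧ ∃ S : Finset (Fin d), 2 ≤ S.card ∧ L = ⨅ i ∈ S, A.plane i}

theorem oneFlats_finite : A.oneFlats.Finite := by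
  refine (Set.finite_range fun S : Finset (Fin d) => ⨅ i ∈ S, A.plane i).subset ?_
  rintro L ⟨-, S, -, rfl⟩
  exact ⟨S, rfl⟩

/-- The multiplicity `d_L`: the number of planes of the arrangement which contain `L`. -/
def multiplicity (L : Submodule ℂ C3) : ℕ := Nat.card {i : Fin d // L ≤ A.plane i}

end CentralArrangement

end

open CategoryTheory AlgebraicTopology

noncomputable section

/-! Everything rests on one additivity principle, the Mayer–Vietoris formula
`HasTopEulerChar.of_cover`: for an open cover by `U` and `V`, finiteness of the total homology and
the value of `χ` pass from `U`, `V`, `U ∩ V` to the whole space, with `χ(U) + χ(V) - χ(U ∩ V)`. Its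
geometric input is that iterated barycentric subdivision makes every singular chain small
(`exists_sub_d_mem_smallChains`); the rest is rank counting in long exact sequences.

A nonzero complex number has positive real part after one of four quarter turns. Hence the common
nonvanishing locus of finitely many affine functions is a finite union of convex open sets, whose
intersections are again convex. So its Euler characteristic exists, and a covering with `n`-point
fibers over it has Euler characteristic `n` times as large: over a convex set the covering deforms
onto a fiber, and Mayer–Vietoris does the rest (`IsCoveringMap.exists_hasTopEulerChar_biUnion`).

The value comes from deletion (`HasTopEulerChar.deletion`). Let `M` be the complement of an affine
arrangement containing the line `y = 0`, let `M'` be the complement when that line is dropped, and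
let `M''` be the part of `M'` on `y = 0`. Then `M'` is the union of `M` and a tube around `M''`. The
tube has the homotopy type of `M''` and the punctured tube has Euler characteristic `0`, so `χ(M') =
χ(M) + χ(M'')`. Since `χ(M)` is already known to exist, this determines it. Projectively, adding a
line to a nonempty arrangement subtracts `2 - k`, where `k` is the number of points in which it
meets the old lines (`HasTopEulerChar.projComp_insert`). Starting from `χ(ℙ²) = 3` and `χ(ℂ²) = 1`,
induction gives the formula, because `k` is also the growth of `∑ (d_L - 1)`
(`sum_multiplicityIn_insert`).

The Milnor fiber is a closed set on which the `d`-th roots of unity act freely with the fibers of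
the projection as orbits. Local `d`-th roots show that the projection is a quotient map, so it is a
`d`-sheeted covering. Normalising one form to `1` makes the base an affine complement, where
multiplicativity applies. -/

/-! ### Singular chains and their basis of simplices -/

/-- The generator of the singular chains given by a singular simplex. -/
def singularGen {X : Type} [TopologicalSpace X] {n : ℕ} (σ : C(stdSimplex ℝ (Fin (n + 1)), X)) :
    (complexSingularChains X).X n :=
  ((TopCat.toSSet.obj (TopCat.of X)).ιChainComplex (R := ModuleCat.of ℂ ℂ)
    ((TopCat.toSSetObjEquiv (TopCat.of X) (Opposite.op (SimplexCategory.mk n))).symm σ)).hom (1 : ℂ)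

/-- The `i`-th face inclusion of standard simplices. -/
def stdFace {n : ℕ} (i : Fin (n + 2)) :
    C(stdSimplex ℝ (Fin (n + 1)), stdSimplex ℝ (Fin (n + 2))) :=
  ⟨stdSimplex.map i.succAbove, stdSimplex.continuous_map _⟩

theorem singularGen_d {X : Type} [TopologicalSpace X] {n : ℕ}
    (σ : C(stdSimplex ℝ (Fin (n + 2)), X)) :
    ((complexSingularChains X).d (n + 1) n).hom (singularGen σ) =
      ∑ i : Fin (n + 2), (-1 : ℂ) ^ (i : ℕ) • singularGen (σ.comp (stdFace i)) := by
  have h := congrArg (fun f => f.hom (1 : ℂ)) ((TopCat.toSSet.obj (TopCat.of X)).ιChainComplex_d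
    (R := ModuleCat.of ℂ ℂ)
    ((TopCat.toSSetObjEquiv (TopCat.of X) (Opposite.op (SimplexCategory.mk (n + 1)))).symm σ))
  refine h.trans ?_
  rw [ModuleCat.hom_sum, LinearMap.sum_apply]
  refine Finset.sum_congr rfl fun i _ => ?_
  -- The library differential carries integer signs and the claim complex ones; the two cases where
  -- they disagree are contradictory.
  rcases neg_one_pow_eq_or ℤ (i : ℕ) with hi | hi <;>
    rcases neg_one_pow_eq_or ℂ (i : ℕ) with hi' | hi'
  · rw [hi, hi', one_smul, one_smul]; rfl
  · exfalso
    have := congrArg (Int.cast : ℤ → ℂ) hi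
    push_cast at this; rw [hi'] at this; norm_num at this
  · exfalso
    have := congrArg (Int.cast : ℤ → ℂ) hi
    push_cast at this; rw [hi'] at this; norm_num at this
  · rw [hi, hi', neg_one_smul, neg_one_smul]; rfl

/-- The chain map induced by a continuous map. -/
def singularMap {X Y : Type} [TopologicalSpace X] [TopologicalSpace Y] (f : C(X, Y)) :
    complexSingularChains X ⟶ complexSingularChains Y :=
  ((singularChainComplexFunctor (ModuleCat.{0} ℂ)).obj (ModuleCat.of ℂ ℂ)).map (TopCat.ofHom f)

theorem singularMap_gen {X Y : Type} [TopologicalSpace X] [TopologicalSpace Y] {n : ℕ}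
    (f : C(X, Y)) (σ : C(stdSimplex ℝ (Fin (n + 1)), X)) :
    ((singularMap f).f n).hom (singularGen σ) = singularGen (f.comp σ) := by
  have h := congrArg (fun f => f.hom (1 : ℂ)) (SSet.ι_chainComplexMap_f (R := ModuleCat.of ℂ ℂ)
    (X := TopCat.toSSet.obj (TopCat.of X)) (Y := TopCat.toSSet.obj (TopCat.of Y))
    (f := TopCat.toSSet.map (TopCat.ofHom f)) (n := n)
    (x := ((TopCat.toSSetObjEquiv (TopCat.of X) (Opposite.op (SimplexCategory.mk n))).symm σ)))
  exact h

theorem singularMap_comp {X Y Z : Type} [TopologicalSpace X] [TopologicalSpace Y]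
    [TopologicalSpace Z] (g : C(Y, Z)) (f : C(X, Y)) :
    singularMap (g.comp f) = singularMap f ≫ singularMap g :=
  ((singularChainComplexFunctor (ModuleCat.{0} ℂ)).obj (ModuleCat.of ℂ ℂ)).map_comp _ _

theorem singularMap_id (X : Type) [TopologicalSpace X] :
    singularMap (ContinuousMap.id X) = 𝟙 _ :=
  ((singularChainComplexFunctor (ModuleCat.{0} ℂ)).obj (ModuleCat.of ℂ ℂ)).map_id _

/-- The singular simplices form a basis of the singular chains. -/
def singularBasis (X : Type) [TopologicalSpace X] (n : ℕ) :
    Module.Basis C(stdSimplex ℝ (Fin (n + 1)), X) ℂ ((complexSingularChains X).X n) :=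
  let e := TopCat.toSSetObjEquiv (TopCat.of X) (Opposite.op (SimplexCategory.mk n))
  let D : (complexSingularChains X).X n ⟶
      ModuleCat.of ℂ (C(stdSimplex ℝ (Fin (n + 1)), X) →₀ ℂ) :=
    Limits.Cofan.IsColimit.desc
      ((TopCat.toSSet.obj (TopCat.of X)).isColimitChainComplexXCofan (ModuleCat.of ℂ ℂ) n)
      fun σ => ModuleCat.ofHom (Finsupp.lsingle (e σ))
  have hD : ∀ σ, D.hom (singularGen σ) = Finsupp.single σ 1 := fun σ => by
    have h := congrArg (fun f => f.hom (1 : ℂ)) (Limits.Cofan.IsColimit.fac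
      ((TopCat.toSSet.obj (TopCat.of X)).isColimitChainComplexXCofan (ModuleCat.of ℂ ℂ) n)
      (fun σ => ModuleCat.ofHom (Finsupp.lsingle (M := ℂ) (R := ℂ) (e σ))) (e.symm σ))
    refine Eq.trans h ?_
    simp
  .ofRepr
    { D.hom with
      invFun := Finsupp.linearCombination ℂ singularGen
      left_inv := fun c => by
        have : D ≫ ModuleCat.ofHom (Finsupp.linearCombination ℂ singularGen) = 𝟙 _ := by
          refine SSet.chainComplex_hom_ext (X := TopCat.toSSet.obj (TopCat.of X))
            (R := ModuleCat.of ℂ ℂ) fun σ => ?_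
          refine ModuleCat.hom_ext (LinearMap.ext_ring ?_)
          have h := hD (e σ)
          have h2 : singularGen (e σ) = ((TopCat.toSSet.obj (TopCat.of X)).ιChainComplex
            (R := ModuleCat.of ℂ ℂ) σ).hom (1 : ℂ) := by
            unfold singularGen
            rw [Equiv.symm_apply_apply]
          rw [h2] at h
          refine (congrArg (Finsupp.linearCombination ℂ singularGen) h).trans ?_
          rw [Finsupp.linearCombination_single, one_smul]
          exact h2
        exact congrArg (fun f => f.hom c) this
      right_inv := fun c => by
        have : D.hom ∘ₗ Finsupp.linearCombination ℂ singularGen = LinearMap.id := by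
          ext σ : 2
          simp [hD]
        exact congrArg (fun f => f c) this }

@[simp]
theorem singularBasis_apply (X : Type) [TopologicalSpace X] (n : ℕ)
    (σ : C(stdSimplex ℝ (Fin (n + 1)), X)) : singularBasis X n σ = singularGen σ := by
  have : singularBasis X n σ = Finsupp.linearCombination ℂ singularGen (Finsupp.single σ 1) := rfl
  rw [this, Finsupp.linearCombination_single, one_smul]

/-! ### Ordered chains and their subdivision -/

/-- Formal linear combinations of `n`-tuples of elements of `V`. -/
abbrev TupleChain (V : Type*) (n : ℕ) : Type _ := (Fin n → V) →₀ ℂ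

namespace TupleChain

variable {V W : Type*} {n : ℕ}

/-- The alternating sum of the faces of a tuple. -/
def bd : TupleChain V (n + 1) →ₗ[ℂ] TupleChain V n :=
  ∑ i : Fin (n + 1), (-1 : ℂ) ^ (i : ℕ) • Finsupp.lmapDomain ℂ ℂ fun v => v ∘ i.succAbove

/-- The cone with apex `b`. -/
def cone (b : V) : TupleChain V n →ₗ[ℂ] TupleChain V (n + 1) :=
  Finsupp.lmapDomain ℂ ℂ (Fin.cons (α := fun _ => V) b)

/-- The map induced by a map of sets of vertices. -/
def map (f : V → W) : TupleChain V n →ₗ[ℂ] TupleChain W n :=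
  Finsupp.lmapDomain ℂ ℂ fun v => f ∘ v

theorem bd_single (v : Fin (n + 1) → V) :
    bd (Finsupp.single v 1) =
      ∑ i : Fin (n + 1), (-1 : ℂ) ^ (i : ℕ) • Finsupp.single (v ∘ i.succAbove) 1 := by
  simp [bd, LinearMap.sum_apply, Finsupp.mapDomain_single]

@[simp]
theorem cone_single (b : V) (v : Fin n → V) (a : ℂ) :
    cone b (Finsupp.single v a) = Finsupp.single (Fin.cons (α := fun _ => V) b v) a := by
  simp [cone, Finsupp.mapDomain_single]

@[simp]
theorem map_single (f : V → W) (v : Fin n → V) (a : ℂ) :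
    map f (Finsupp.single v a) = Finsupp.single (f ∘ v) a := by
  simp [map, Finsupp.mapDomain_single]

/-- Face `0` of a cone is its base, and face `i + 1` is the cone over face `i` with the opposite
sign. All later identities are formal consequences. -/
theorem bd_cone (b : V) (c : TupleChain V (n + 1)) : bd (cone b c) = c - cone b (bd c) := by
  suffices h : bd ∘ₗ cone b = LinearMap.id - cone b ∘ₗ bd (V := V) (n := n) from
    congrArg (fun f => f c) h
  ext v : 2
  simp only [LinearMap.comp_apply, Finsupp.lsingle_apply, LinearMap.sub_apply, LinearMap.id_apply,
    cone_single, bd_single, map_sum, map_smul]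
  rw [Fin.sum_univ_succ]
  have h0 : (Fin.cons (α := fun _ => V) b v) ∘ (0 : Fin (n + 2)).succAbove = v := by
    ext j; simp
  have h1 (i : Fin (n + 1)) : (Fin.cons (α := fun _ => V) b v) ∘ i.succ.succAbove =
      Fin.cons (α := fun _ => V) b (v ∘ i.succAbove) := by
    ext j
    refine Fin.cases ?_ (fun j => ?_) j <;> simp
  simp only [h0, h1, Fin.val_zero, pow_zero, one_smul, Fin.val_succ, pow_succ, mul_neg_one,
    neg_smul, Finset.sum_neg_distrib]
  abel

/-- Degrees count vertices, so degree `0` is spanned by the empty tuple and the complex is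
augmented. The empty tuple has no faces, hence no correction term here. -/
theorem bd_cone_zero (b : V) (c : TupleChain V 0) : bd (cone b c) = c := by
  suffices h : bd ∘ₗ cone b = LinearMap.id (R := ℂ) (M := TupleChain V 0) from
    congrArg (fun f => f c) h
  ext v : 2
  simp only [LinearMap.comp_apply, Finsupp.lsingle_apply, LinearMap.id_apply, cone_single,
    bd_single]
  rw [Fin.sum_univ_one]
  simp only [Fin.val_zero, pow_zero, one_smul]
  congr 1

/-- Every tuple is the cone from its first vertex over the rest, so the cone formula reduces the
claim to one degree lower. -/
theorem bd_bd (c : TupleChain V (n + 2)) : bd (bd c) = 0 := by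
  induction n with
  | zero =>
    suffices h : bd ∘ₗ bd = (0 : TupleChain V 2 →ₗ[ℂ] TupleChain V 0) from
      congrArg (fun f => f c) h
    ext v : 2
    obtain ⟨b, w, rfl⟩ : ∃ b w, v = Fin.cons (α := fun _ => V) b w :=
      ⟨v 0, Fin.tail v, (Fin.cons_self_tail v).symm⟩
    simp only [LinearMap.comp_apply, Finsupp.lsingle_apply, LinearMap.zero_apply]
    rw [← cone_single, bd_cone, map_sub, bd_cone_zero, sub_self]
  | succ n ih =>
    suffices h : bd ∘ₗ bd = (0 : TupleChain V (n + 3) →ₗ[ℂ] TupleChain V (n + 1)) from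
      congrArg (fun f => f c) h
    ext v : 2
    obtain ⟨b, w, rfl⟩ : ∃ b w, v = Fin.cons (α := fun _ => V) b w :=
      ⟨v 0, Fin.tail v, (Fin.cons_self_tail v).symm⟩
    simp only [LinearMap.comp_apply, Finsupp.lsingle_apply, LinearMap.zero_apply]
    rw [← cone_single, bd_cone, map_sub, bd_cone, ih, map_zero, sub_zero, sub_self]

theorem map_bd (f : V → W) (c : TupleChain V (n + 1)) : map f (bd c) = bd (map f c) := by
  suffices h : map f ∘ₗ bd = bd ∘ₗ map f (n := n + 1) from congrArg (fun f => f c) h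
  ext v : 2
  simp [bd_single, Function.comp_assoc]

theorem map_cone (f : V → W) (b : V) (c : TupleChain V n) :
    map f (cone b c) = cone (f b) (map f c) := by
  suffices h : map f ∘ₗ cone b = cone (f b) ∘ₗ map f (n := n) from congrArg (fun f => f c) h
  ext v : 2
  simp only [LinearMap.comp_apply, Finsupp.lsingle_apply, cone_single, map_single]
  congr 1
  ext j
  refine Fin.cases ?_ (fun j => ?_) j <;> simp

variable (β : ∀ {n : ℕ}, (Fin (n + 1) → V) → V) (γ : ∀ {n : ℕ}, (Fin (n + 1) → W) → W)

/-- The subdivision operator determined by a choice of a "barycenter" for each tuple. -/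
def sd : ∀ n, TupleChain V n →ₗ[ℂ] TupleChain V n
  | 0 => LinearMap.id
  | n + 1 => Finsupp.linearCombination ℂ fun v => cone (β v) (sd n (bd (Finsupp.single v 1)))

/-- The homotopy from the subdivision operator to the identity. -/
def sdHomotopy : ∀ n, TupleChain V n →ₗ[ℂ] TupleChain V (n + 1)
  | 0 => 0
  | n + 1 => Finsupp.linearCombination ℂ fun v =>
      cone (β v) (Finsupp.single v 1 - sdHomotopy n (bd (Finsupp.single v 1)))

theorem sd_single (v : Fin (n + 1) → V) :
    sd β (n + 1) (Finsupp.single v 1) = cone (β v) (sd β n (bd (Finsupp.single v 1))) := by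
  rw [sd, Finsupp.linearCombination_single, one_smul]

theorem sdHomotopy_single (v : Fin (n + 1) → V) :
    sdHomotopy β (n + 1) (Finsupp.single v 1) =
      cone (β v) (Finsupp.single v 1 - sdHomotopy β n (bd (Finsupp.single v 1))) := by
  rw [sdHomotopy, Finsupp.linearCombination_single, one_smul]

theorem bd_sd (c : TupleChain V (n + 1)) : bd (sd β (n + 1) c) = sd β n (bd c) := by
  induction n with
  | zero =>
    suffices h : bd ∘ₗ sd β 1 = sd β 0 ∘ₗ bd from congrArg (fun f => f c) h
    ext v : 2
    simp only [LinearMap.comp_apply, Finsupp.lsingle_apply, sd_single, bd_cone_zero]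
  | succ n ih =>
    suffices h : bd ∘ₗ sd β (n + 2) = sd β (n + 1) ∘ₗ bd from congrArg (fun f => f c) h
    ext v : 2
    simp only [LinearMap.comp_apply, Finsupp.lsingle_apply, sd_single, bd_cone]
    rw [ih, bd_bd, map_zero, map_zero, sub_zero]

/-- The homotopy `T` is the cone over `v - T ∂v`. By induction this chain has boundary `sd ∂v`,
whose cone is `sd v`, so the cone formula gives the identity. -/
theorem bd_sdHomotopy (c : TupleChain V (n + 1)) :
    bd (sdHomotopy β (n + 1) c) + sdHomotopy β n (bd c) = c - sd β (n + 1) c := by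
  induction n with
  | zero =>
    suffices h : bd ∘ₗ sdHomotopy β 1 + sdHomotopy β 0 ∘ₗ bd = LinearMap.id - sd β 1 from
      congrArg (fun f => f c) h
    ext v : 2
    simp only [LinearMap.comp_apply, Finsupp.lsingle_apply, LinearMap.add_apply,
      LinearMap.sub_apply, LinearMap.id_apply, sd_single, sdHomotopy_single, bd_cone]
    simp [sd, sdHomotopy]
  | succ n ih =>
    suffices h : bd ∘ₗ sdHomotopy β (n + 2) + sdHomotopy β (n + 1) ∘ₗ bd =
        LinearMap.id - sd β (n + 2) from congrArg (fun f => f c) h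
    ext v : 2
    simp only [LinearMap.comp_apply, Finsupp.lsingle_apply, LinearMap.add_apply,
      LinearMap.sub_apply, LinearMap.id_apply, sd_single, sdHomotopy_single, bd_cone]
    have := ih (bd (Finsupp.single v 1))
    rw [bd_bd, map_zero, add_zero] at this
    rw [map_sub, this, sub_sub_cancel]
    abel

/-- Naturality under maps that respect the chosen barycenters. It will be used for affine maps of
simplices, in particular face inclusions. -/
theorem map_sd (f : V → W) (hf : ∀ {n : ℕ} (v : Fin (n + 1) → V), f (β v) = γ (f ∘ v))
    (c : TupleChain V n) : map f (sd β n c) = sd γ n (map f c) := by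
  induction n with
  | zero => rfl
  | succ n ih =>
    suffices h : map f ∘ₗ sd β (n + 1) = sd γ (n + 1) ∘ₗ map f from congrArg (fun f => f c) h
    ext v : 2
    simp only [LinearMap.comp_apply, Finsupp.lsingle_apply, sd_single, map_cone, hf, ih, map_bd,
      map_single]

theorem map_sdHomotopy (f : V → W) (hf : ∀ {n : ℕ} (v : Fin (n + 1) → V), f (β v) = γ (f ∘ v))
    (c : TupleChain V n) : map f (sdHomotopy β n c) = sdHomotopy γ n (map f c) := by
  induction n with
  | zero => simp [sdHomotopy]
  | succ n ih =>
    suffices h : map f ∘ₗ sdHomotopy β (n + 1) = sdHomotopy γ (n + 1) ∘ₗ map f from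
      congrArg (fun f => f c) h
    ext v : 2
    simp only [LinearMap.comp_apply, Finsupp.lsingle_apply, sdHomotopy_single, map_cone, hf, ih,
      map_bd, map_single, map_sub]

/-- The homotopy from the iterated subdivision operator to the identity. -/
def sdIterHomotopy (m n : ℕ) : TupleChain V n →ₗ[ℂ] TupleChain V (n + 1) :=
  ∑ j ∈ Finset.range m, sdHomotopy β n ∘ₗ sd β n ^ j

theorem bd_sd_pow (m : ℕ) (c : TupleChain V (n + 1)) :
    bd ((sd β (n + 1) ^ m) c) = (sd β n ^ m) (bd c) := by
  induction m with
  | zero => rfl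
  | succ m ih => rw [pow_succ', pow_succ', Module.End.mul_apply, Module.End.mul_apply, bd_sd, ih]

/-- The one-step homotopies applied to `sd ^ j` telescope. -/
theorem bd_sdIterHomotopy (m : ℕ) (c : TupleChain V (n + 1)) :
    bd (sdIterHomotopy β m (n + 1) c) + sdIterHomotopy β m n (bd c) =
      c - (sd β (n + 1) ^ m) c := by
  simp only [sdIterHomotopy, LinearMap.sum_apply, map_sum, LinearMap.comp_apply,
    ← Finset.sum_add_distrib, ← bd_sd_pow, bd_sdHomotopy]
  simp only [← Module.End.mul_apply, ← pow_succ']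
  rw [Finset.sum_range_sub']
  simp

theorem sdIterHomotopy_zero (m : ℕ) (c : TupleChain V 0) : sdIterHomotopy β m 0 c = 0 := by
  simp [sdIterHomotopy, sdHomotopy]

theorem map_sd_pow (f : V → W) (hf : ∀ {n : ℕ} (v : Fin (n + 1) → V), f (β v) = γ (f ∘ v))
    (m : ℕ) (c : TupleChain V n) : map f ((sd β n ^ m) c) = (sd γ n ^ m) (map f c) := by
  induction m with
  | zero => rfl
  | succ m ih =>
    rw [pow_succ', pow_succ', Module.End.mul_apply, Module.End.mul_apply, map_sd β γ f hf, ih]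

theorem map_sdIterHomotopy (f : V → W)
    (hf : ∀ {n : ℕ} (v : Fin (n + 1) → V), f (β v) = γ (f ∘ v))
    (m : ℕ) (c : TupleChain V n) :
    map f (sdIterHomotopy β m n c) = sdIterHomotopy γ m n (map f c) := by
  simp only [sdIterHomotopy, LinearMap.sum_apply, map_sum, LinearMap.comp_apply,
    map_sdHomotopy β γ f hf, map_sd_pow β γ f hf]

end TupleChain

/-! ### Affine simplices and small chains -/

/-- The affine map of simplices with prescribed vertices. -/
def affSimplex {n m : ℕ} (v : Fin (n + 1) → stdSimplex ℝ (Fin (m + 1))) :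
    C(stdSimplex ℝ (Fin (n + 1)), stdSimplex ℝ (Fin (m + 1))) where
  toFun t := ⟨∑ i, t.1 i • (v i).1,
    (convex_stdSimplex ℝ (Fin (m + 1))).sum_mem (fun i _ => t.2.1 i) t.2.2 fun i _ => (v i).2⟩
  continuous_toFun := by
    refine Continuous.subtype_mk (continuous_finsetSum _ fun i _ => ?_) _
    exact ((continuous_apply i).comp continuous_subtype_val).smul continuous_const

theorem affSimplex_coe {n m : ℕ} (v : Fin (n + 1) → stdSimplex ℝ (Fin (m + 1)))
    (t : stdSimplex ℝ (Fin (n + 1))) : (affSimplex v t).1 = ∑ i, t.1 i • (v i).1 := rfl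

theorem affSimplex_comp {n m k : ℕ} (u : Fin (m + 1) → stdSimplex ℝ (Fin (k + 1)))
    (v : Fin (n + 1) → stdSimplex ℝ (Fin (m + 1))) :
    (affSimplex u).comp (affSimplex v) = affSimplex (affSimplex u ∘ v) := by
  ext t : 1
  refine Subtype.ext ?_
  simp only [ContinuousMap.comp_apply, Function.comp_apply, affSimplex_coe, Finset.sum_apply,
    Pi.smul_apply, Finset.sum_smul, Finset.smul_sum, smul_assoc]
  exact Finset.sum_comm

theorem affSimplex_face {n m : ℕ} (v : Fin (n + 2) → stdSimplex ℝ (Fin (m + 1))) (i : Fin (n + 2)) :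
    (affSimplex v).comp (stdFace i) = affSimplex (v ∘ i.succAbove) := by
  ext t : 1
  refine Subtype.ext ?_
  simp only [ContinuousMap.comp_apply, Function.comp_apply, affSimplex_coe]
  have h : ∀ j, (stdFace i t).1 j = FunOnFinite.linearMap ℝ ℝ i.succAbove t.1 j := fun j => rfl
  simp only [h]
  rw [Fin.sum_univ_succAbove _ i]
  simp [FunOnFinite.linearMap_apply_apply, Finset.filter_eq']

theorem affSimplex_vertex (n : ℕ) :
    affSimplex (fun i : Fin (n + 1) => stdSimplex.vertex (S := ℝ) i) = ContinuousMap.id _ := by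
  ext t : 1
  refine Subtype.ext ?_
  ext j
  simp [affSimplex_coe, Pi.single_apply]

theorem affSimplex_apply_vertex {n m : ℕ} (v : Fin (n + 1) → stdSimplex ℝ (Fin (m + 1)))
    (j : Fin (n + 1)) : affSimplex v (stdSimplex.vertex (S := ℝ) j) = v j := by
  refine Subtype.ext ?_
  simp [affSimplex_coe, Pi.single_apply]

/-- The barycenter of a tuple of points of a standard simplex. -/
def tupleBarycenter {m n : ℕ} (v : Fin (n + 1) → stdSimplex ℝ (Fin (m + 1))) :
    stdSimplex ℝ (Fin (m + 1)) := affSimplex v stdSimplex.barycenter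

theorem affSimplex_tupleBarycenter {m k n : ℕ} (u : Fin (m + 1) → stdSimplex ℝ (Fin (k + 1)))
    (v : Fin (n + 1) → stdSimplex ℝ (Fin (m + 1))) :
    affSimplex u (tupleBarycenter v) = tupleBarycenter (affSimplex u ∘ v) := by
  unfold tupleBarycenter
  rw [← affSimplex_comp]
  rfl

theorem affSimplex_mem_convexHull {m n : ℕ} (v : Fin (n + 1) → stdSimplex ℝ (Fin (m + 1)))
    (t : stdSimplex ℝ (Fin (n + 1))) :
    (affSimplex v t).1 ∈ convexHull ℝ (Set.range fun j => (v j).1) :=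
  (convex_convexHull ℝ _).sum_mem (fun i _ => t.2.1 i) t.2.2 fun i _ =>
    subset_convexHull ℝ _ ⟨i, rfl⟩

theorem dist_affSimplex_le {m n : ℕ} (v : Fin (n + 1) → stdSimplex ℝ (Fin (m + 1)))
    {D : ℝ} (hD : ∀ i j, dist (v i) (v j) ≤ D) (t : stdSimplex ℝ (Fin (n + 1))) :
    dist (affSimplex v t) (v 0) ≤ D := by
  have h : convexHull ℝ (Set.range fun j => (v j).1) ⊆ Metric.closedBall (v 0).1 D :=
    convexHull_min (by rintro _ ⟨j, rfl⟩; exact hD j 0) (convex_closedBall _ _)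
  exact h (affSimplex_mem_convexHull v t)

/-- The vector from `v k` to the barycenter is the average of `n + 1` differences, one of which is
zero; this gives a contraction factor below `1`. -/
theorem dist_tupleBarycenter_le {m n : ℕ} (v : Fin (n + 1) → stdSimplex ℝ (Fin (m + 1)))
    {D : ℝ} (hD : ∀ i j, dist (v i) (v j) ≤ D) (k : Fin (n + 1)) :
    dist (tupleBarycenter v) (v k) ≤ n / (n + 1) * D := by
  have hn : (0 : ℝ) < n + 1 := by positivity
  have h1 : (tupleBarycenter v).1 - (v k).1 = ∑ i, (1 / (n + 1 : ℝ)) • ((v i).1 - (v k).1) := by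
    have : ∀ i, (stdSimplex.barycenter (𝕜 := ℝ) (X := Fin (n + 1))).1 i = 1 / (n + 1 : ℝ) := by
      intro i
      refine (stdSimplex.barycenter_apply i).trans ?_
      simp
    rw [tupleBarycenter, affSimplex_coe]
    simp only [this, smul_sub, Finset.sum_sub_distrib, Finset.sum_const, Finset.card_univ,
      Fintype.card_fin]
    congr 1
    rw [← Nat.cast_smul_eq_nsmul ℝ, smul_smul]
    push_cast
    rw [mul_one_div_cancel hn.ne', one_smul]
  rw [Subtype.dist_eq, dist_eq_norm, h1]
  refine (norm_sum_le _ _).trans ?_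
  rw [Fin.sum_univ_succAbove _ k]
  have h2 : ∀ i, ‖(1 / (n + 1 : ℝ)) • ((v i).1 - (v k).1)‖ ≤ 1 / (n + 1) * D := by
    intro i
    rw [norm_smul, Real.norm_of_nonneg (by positivity)]
    refine mul_le_mul_of_nonneg_left ?_ (by positivity)
    rw [← dist_eq_norm]
    exact hD i k
  rw [sub_self, smul_zero, norm_zero, zero_add]
  refine (Finset.sum_le_sum fun i _ => h2 _).trans (le_of_eq ?_)
  rw [Finset.sum_const, Finset.card_univ, Fintype.card_fin, nsmul_eq_mul]
  ring

namespace TupleChain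

theorem linearMap_mem_of_supported {V M : Type*} [AddCommGroup M] [Module ℂ M] {k : ℕ}
    (f : TupleChain V k →ₗ[ℂ] M)
    {s : Set (Fin k → V)} {p : Submodule ℂ M} (h : ∀ v ∈ s, f (Finsupp.single v 1) ∈ p)
    {c : TupleChain V k} (hc : c ∈ Finsupp.supported ℂ ℂ s) : f c ∈ p := by
  rw [← Finsupp.sum_single c, Finsupp.sum, map_sum]
  refine Submodule.sum_mem _ fun v hv => ?_
  rw [← mul_one (c v), ← smul_eq_mul, ← Finsupp.smul_single, map_smul]
  exact p.smul_mem _ (h v (hc hv))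

/-- Here `k` counts vertices, so `k / (k + 1)` is weaker than the classical `(k - 1) / k`; any
factor below `1` suffices. The convex hull clause serves the induction: it bounds the distance from
the new apex to vertices coming from a subdivided face. -/
theorem sd_single_mem {m k : ℕ} (v : Fin k → stdSimplex ℝ (Fin (m + 1))) {D : ℝ}
    (hD : ∀ i j, dist (v i) (v j) ≤ D) :
    sd tupleBarycenter k (Finsupp.single v 1) ∈ Finsupp.supported ℂ ℂ
      {w | (∀ j, (w j).1 ∈ convexHull ℝ (Set.range fun i => (v i).1)) ∧
        ∀ i j, dist (w i) (w j) ≤ (k / (k + 1) : ℝ) * D} := by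
  induction k with
  | zero =>
    refine Finsupp.single_mem_supported ℂ _ ⟨fun j => j.elim0, fun j => j.elim0⟩
  | succ k ih =>
    have hD0 : 0 ≤ D := dist_nonneg.trans (hD 0 0)
    have hk : (k / (k + 1) : ℝ) * D ≤ ((k + 1 : ℕ) / ((k + 1 : ℕ) + 1) : ℝ) * D := by
      refine mul_le_mul_of_nonneg_right ?_ hD0
      rw [div_le_div_iff₀ (by positivity) (by positivity)]
      push_cast
      nlinarith
    rw [sd_single]
    have key : sd tupleBarycenter k (bd (Finsupp.single v 1)) ∈ Finsupp.supported ℂ ℂ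
        {w : Fin k → stdSimplex ℝ (Fin (m + 1)) |
          (∀ j, (w j).1 ∈ convexHull ℝ (Set.range fun i => (v i).1)) ∧
          ∀ i j, dist (w i) (w j) ≤ (k / (k + 1) : ℝ) * D} := by
      rw [bd_single, map_sum]
      refine Submodule.sum_mem _ fun i _ => ?_
      rw [map_smul]
      refine Submodule.smul_mem _ _ (Finsupp.supported_mono ?_
        (ih (v ∘ i.succAbove) fun a b => hD _ _))
      rintro w ⟨h1, h2⟩
      refine ⟨fun j => convexHull_mono ?_ (h1 j), h2⟩
      rintro _ ⟨a, rfl⟩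
      exact ⟨_, rfl⟩
    refine linearMap_mem_of_supported (cone (tupleBarycenter v)) (fun w hw => ?_) key
    rw [cone_single]
    have hb : ∀ j, dist (tupleBarycenter v) (w j) ≤ ((k + 1 : ℕ) / ((k + 1 : ℕ) + 1) : ℝ) * D := by
      intro j
      -- A ball about the barycenter containing all the `v i` contains their convex hull, hence
      -- every vertex of the subdivided faces.
      have : convexHull ℝ (Set.range fun i => (v i).1) ⊆
          Metric.closedBall (tupleBarycenter v).1 ((k / (k + 1) : ℝ) * D) :=
        convexHull_min (by
          rintro _ ⟨i, rfl⟩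
          rw [Metric.mem_closedBall, dist_comm]
          exact dist_tupleBarycenter_le v hD i) (convex_closedBall _ _)
      have h := this (hw.1 j)
      rw [Metric.mem_closedBall, dist_comm] at h
      exact h.trans hk
    refine Finsupp.single_mem_supported ℂ _ ⟨fun j => ?_, fun i j => ?_⟩
    · refine Fin.cases ?_ (fun j => ?_) j
      · exact affSimplex_mem_convexHull v _
      · exact hw.1 j
    · refine Fin.cases ?_ (fun i => ?_) i <;> refine Fin.cases ?_ (fun j => ?_) j
      · simp only [Fin.cons_zero, dist_self]; positivity
      · exact hb j
      · rw [dist_comm]; exact hb i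
      · exact (hw.2 i j).trans hk

theorem sd_pow_single_mem {m k : ℕ} (v : Fin k → stdSimplex ℝ (Fin (m + 1))) {D : ℝ}
    (hD : ∀ i j, dist (v i) (v j) ≤ D) (N : ℕ) :
    (sd tupleBarycenter k ^ N) (Finsupp.single v 1) ∈ Finsupp.supported ℂ ℂ
      {w | ∀ i j, dist (w i) (w j) ≤ (k / (k + 1) : ℝ) ^ N * D} := by
  induction N with
  | zero => exact Finsupp.single_mem_supported ℂ _ fun i j => by simpa using hD i j
  | succ N ih =>
    rw [pow_succ' (sd tupleBarycenter k), Module.End.mul_apply]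
    refine linearMap_mem_of_supported _ (fun w hw => ?_) ih
    refine Finsupp.supported_mono ?_ (sd_single_mem w hw)
    intro u hu i j
    refine (hu.2 i j).trans (le_of_eq ?_)
    ring

end TupleChain

/-- The singular chain obtained from a chain of affine simplices by composing with a singular
simplex. -/
def affPush {X : Type} [TopologicalSpace X] {m : ℕ} (σ : C(stdSimplex ℝ (Fin (m + 1)), X)) (n : ℕ) :
    TupleChain (stdSimplex ℝ (Fin (m + 1))) (n + 1) →ₗ[ℂ] (complexSingularChains X).X n :=
  Finsupp.linearCombination ℂ fun v => singularGen (σ.comp (affSimplex v))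

section
variable {X : Type} [TopologicalSpace X] {m n : ℕ}

theorem affPush_single (σ : C(stdSimplex ℝ (Fin (m + 1)), X))
    (v : Fin (n + 1) → stdSimplex ℝ (Fin (m + 1))) :
    affPush σ n (Finsupp.single v 1) = singularGen (σ.comp (affSimplex v)) := by
  rw [affPush, Finsupp.linearCombination_single, one_smul]

theorem d_affPush (σ : C(stdSimplex ℝ (Fin (m + 1)), X))
    (c : TupleChain (stdSimplex ℝ (Fin (m + 1))) (n + 2)) :
    ((complexSingularChains X).d (n + 1) n).hom (affPush σ (n + 1) c) =
      affPush σ n (TupleChain.bd c) := by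
  suffices h : ((complexSingularChains X).d (n + 1) n).hom ∘ₗ affPush σ (n + 1) =
    affPush σ n ∘ₗ TupleChain.bd from congrArg (fun f => f c) h
  ext v : 2
  simp only [LinearMap.comp_apply, Finsupp.lsingle_apply, affPush_single, singularGen_d,
    TupleChain.bd_single, map_sum, map_smul, ContinuousMap.comp_assoc, affSimplex_face]

theorem affPush_comp {k : ℕ} (σ : C(stdSimplex ℝ (Fin (m + 1)), X))
    (u : Fin (k + 1) → stdSimplex ℝ (Fin (m + 1)))
    (c : TupleChain (stdSimplex ℝ (Fin (k + 1))) (n + 1)) :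
    affPush (σ.comp (affSimplex u)) n c = affPush σ n (TupleChain.map (affSimplex u) c) := by
  suffices h : affPush (σ.comp (affSimplex u)) n =
    affPush σ n ∘ₗ TupleChain.map (affSimplex u) from congrArg (fun f => f c) h
  ext v : 2
  simp only [LinearMap.comp_apply, Finsupp.lsingle_apply, affPush_single, TupleChain.map_single,
    ContinuousMap.comp_assoc, affSimplex_comp]

end

/-- The generic affine simplex. -/
def vertexTuple (n : ℕ) : TupleChain (stdSimplex ℝ (Fin (n + 1))) (n + 1) :=
  Finsupp.single (fun i => stdSimplex.vertex (S := ℝ) i) 1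

theorem affPush_vertexTuple {X : Type} [TopologicalSpace X] {n : ℕ}
    (σ : C(stdSimplex ℝ (Fin (n + 1)), X)) : affPush σ n (vertexTuple n) = singularGen σ := by
  rw [vertexTuple, affPush_single, affSimplex_vertex, ContinuousMap.comp_id]

/-! ### Subdivision of singular chains -/

/-- The iterated subdivision of singular chains. -/
def singularSd (X : Type) [TopologicalSpace X] (N n : ℕ) :
    (complexSingularChains X).X n →ₗ[ℂ] (complexSingularChains X).X n :=
  (singularBasis X n).constr ℂ fun σ =>
    affPush σ n ((TupleChain.sd tupleBarycenter (n + 1) ^ N) (vertexTuple n))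

/-- The homotopy between the iterated subdivision of singular chains and the identity. -/
def singularSdHomotopy (X : Type) [TopologicalSpace X] (N n : ℕ) :
    (complexSingularChains X).X n →ₗ[ℂ] (complexSingularChains X).X (n + 1) :=
  (singularBasis X n).constr ℂ fun σ =>
    affPush σ (n + 1) (TupleChain.sdIterHomotopy tupleBarycenter N (n + 1) (vertexTuple n))

section
variable {X : Type} [TopologicalSpace X]

theorem singularSd_gen (N : ℕ) {n : ℕ} (σ : C(stdSimplex ℝ (Fin (n + 1)), X)) :
    singularSd X N n (singularGen σ) =
      affPush σ n ((TupleChain.sd tupleBarycenter (n + 1) ^ N) (vertexTuple n)) := by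
  rw [← singularBasis_apply, singularSd, Module.Basis.constr_basis]

theorem singularSdHomotopy_gen (N : ℕ) {n : ℕ} (σ : C(stdSimplex ℝ (Fin (n + 1)), X)) :
    singularSdHomotopy X N n (singularGen σ) =
      affPush σ (n + 1) (TupleChain.sdIterHomotopy tupleBarycenter N (n + 1) (vertexTuple n)) := by
  rw [← singularBasis_apply, singularSdHomotopy, Module.Basis.constr_basis]

theorem d_singularSdHomotopy_zero (N : ℕ) (c : (complexSingularChains X).X 0) :
    ((complexSingularChains X).d 1 0).hom (singularSdHomotopy X N 0 c) = c - singularSd X N 0 c := by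
  suffices h : ((complexSingularChains X).d 1 0).hom ∘ₗ singularSdHomotopy X N 0 =
    LinearMap.id - singularSd X N 0 from congrArg (fun f => f c) h
  refine (singularBasis X 0).ext fun σ => ?_
  simp only [LinearMap.comp_apply, LinearMap.sub_apply, LinearMap.id_apply, singularBasis_apply,
    singularSd_gen, singularSdHomotopy_gen, d_affPush]
  have := TupleChain.bd_sdIterHomotopy (V := stdSimplex ℝ (Fin 1)) tupleBarycenter N (vertexTuple 0)
  rw [TupleChain.sdIterHomotopy_zero, add_zero] at this
  rw [this, map_sub, affPush_vertexTuple]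

/-- On a generator this is the tuple identity for the generic affine simplex pushed forward along
`σ`. What remains is to match the homotopy on each face of `σ` with the homotopy on the
corresponding face of the generic simplex. -/
theorem d_singularSdHomotopy_succ (N : ℕ) {n : ℕ} (c : (complexSingularChains X).X (n + 1)) :
    ((complexSingularChains X).d (n + 2) (n + 1)).hom (singularSdHomotopy X N (n + 1) c) +
      singularSdHomotopy X N n (((complexSingularChains X).d (n + 1) n).hom c) =
        c - singularSd X N (n + 1) c := by
  suffices h : ((complexSingularChains X).d (n + 2) (n + 1)).hom ∘ₗ singularSdHomotopy X N (n + 1) +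
      singularSdHomotopy X N n ∘ₗ ((complexSingularChains X).d (n + 1) n).hom =
    LinearMap.id - singularSd X N (n + 1) from congrArg (fun f => f c) h
  refine (singularBasis X (n + 1)).ext fun σ => ?_
  simp only [LinearMap.comp_apply, LinearMap.sub_apply, LinearMap.add_apply, LinearMap.id_apply,
    singularBasis_apply, singularSd_gen, singularSdHomotopy_gen, d_affPush, singularGen_d, map_sum,
    map_smul]
  have h := TupleChain.bd_sdIterHomotopy (V := stdSimplex ℝ (Fin (n + 2))) tupleBarycenter N
    (vertexTuple (n + 1))
  rw [← eq_sub_iff_add_eq] at h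
  rw [h, map_sub, map_sub, affPush_vertexTuple, sub_add_eq_add_sub, add_sub_assoc, add_eq_left,
    sub_eq_zero]
  rw [show TupleChain.bd (vertexTuple (n + 1)) = _ from TupleChain.bd_single _, map_sum, map_sum]
  refine Finset.sum_congr rfl fun i _ => ?_
  rw [map_smul, map_smul]
  congr 1
  -- A face inclusion is itself an affine simplex, so it preserves barycenters and naturality
  -- applies.
  have hf : stdFace i =
      affSimplex ((fun j : Fin (n + 2) => stdSimplex.vertex (S := ℝ) j) ∘ i.succAbove) := by
    rw [← affSimplex_face, affSimplex_vertex, ContinuousMap.id_comp]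
  rw [hf, affPush_comp, TupleChain.map_sdIterHomotopy tupleBarycenter tupleBarycenter _
    (affSimplex_tupleBarycenter _), vertexTuple, TupleChain.map_single]
  exact congrArg (fun v => affPush σ (n + 1)
      (TupleChain.sdIterHomotopy tupleBarycenter N (n + 1) (Finsupp.single v 1)))
    (funext fun j => affSimplex_apply_vertex _ j)

end

/-! ### Small chains for a cover by two open sets -/

section
variable {X : Type} [TopologicalSpace X]

/-- The chains spanned by the singular simplices contained in `U` or in `V`. -/
def smallChains (U V : Set X) (n : ℕ) : Submodule ℂ ((complexSingularChains X).X n) :=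
  Submodule.span ℂ (singularGen '' {σ | Set.range σ ⊆ U ∨ Set.range σ ⊆ V})

theorem affPush_mem_smallChains {U V : Set X} {m : ℕ} {σ : C(stdSimplex ℝ (Fin (m + 1)), X)}
    (hσ : Set.range σ ⊆ U ∨ Set.range σ ⊆ V) (n : ℕ)
    (c : TupleChain (stdSimplex ℝ (Fin (m + 1))) (n + 1)) :
    affPush σ n c ∈ smallChains U V n := by
  refine TupleChain.linearMap_mem_of_supported (s := Set.univ) _ (fun v _ => ?_)
    (by rw [Finsupp.supported_univ]; trivial)
  rw [affPush_single]
  refine Submodule.subset_span ⟨_, ?_, rfl⟩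
  have : Set.range (σ.comp (affSimplex v)) ⊆ Set.range σ := by
    rintro _ ⟨t, rfl⟩
    exact ⟨_, rfl⟩
  exact hσ.imp this.trans this.trans

theorem singularSdHomotopy_mem_smallChains {U V : Set X} (N : ℕ) {n : ℕ}
    {c : (complexSingularChains X).X n} (hc : c ∈ smallChains U V n) :
    singularSdHomotopy X N n c ∈ smallChains U V (n + 1) := by
  have : smallChains U V n ≤ (smallChains U V (n + 1)).comap (singularSdHomotopy X N n) := by
    refine Submodule.span_le.2 ?_
    rintro _ ⟨σ, hσ, rfl⟩
    rw [SetLike.mem_coe, Submodule.mem_comap, singularSdHomotopy_gen]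
    exact affPush_mem_smallChains hσ _ _
  exact this hc

/-- The preimages of `U` and `V` cover a compact simplex and so have a Lebesgue number, while the
mesh of the iterated subdivision tends to zero. Stating this for all large `N` lets finitely many
simplices share one `N`. -/
theorem eventually_singularSd_gen_mem {U V : Set X} (hU : IsOpen U) (hV : IsOpen V)
    (hUV : U ∪ V = Set.univ) {n : ℕ} (σ : C(stdSimplex ℝ (Fin (n + 1)), X)) :
    ∀ᶠ N in Filter.atTop, singularSd X N n (singularGen σ) ∈ smallChains U V n := by
  obtain ⟨δ, hδ, hcov⟩ := lebesgue_number_lemma_of_metric (s := Set.univ)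
    (c := fun b : Bool => σ ⁻¹' (if b then U else V)) isCompact_univ
    (fun b => by cases b <;> simp [hU.preimage σ.continuous, hV.preimage σ.continuous])
    (fun x _ => by
      have : σ x ∈ U ∪ V := hUV ▸ Set.mem_univ _
      rcases this with h | h
      · exact Set.mem_iUnion.2 ⟨true, by simpa using h⟩
      · exact Set.mem_iUnion.2 ⟨false, by simpa using h⟩)
  -- `D` bounds distances to one vertex, so `D + D` bounds all mutual distances before subdividing.
  obtain ⟨D, hD⟩ := (isCompact_univ (X := stdSimplex ℝ (Fin (n + 1)))).isBounded.subset_closedBall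
    (stdSimplex.vertex (S := ℝ) 0)
  have hlim : Filter.Tendsto (fun N : ℕ => (((n + 1 : ℕ) : ℝ) / ((n + 1 : ℕ) + 1)) ^ N * (D + D))
      Filter.atTop (nhds 0) := by
    have := (tendsto_pow_atTop_nhds_zero_of_lt_one (r := ((n + 1 : ℕ) : ℝ) / ((n + 1 : ℕ) + 1))
      (by positivity) (by rw [div_lt_one (by positivity)]; linarith)).mul_const (D + D)
    rwa [zero_mul] at this
  filter_upwards [hlim.eventually_lt_const hδ] with N hN
  rw [singularSd_gen]
  refine TupleChain.linearMap_mem_of_supported _ (fun v hv => ?_)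
    (TupleChain.sd_pow_single_mem _ (D := D + D) (fun i j => ?_) N)
  · rw [affPush_single]
    refine Submodule.subset_span ⟨_, ?_, rfl⟩
    obtain ⟨b, hb⟩ := hcov (v 0) (Set.mem_univ _)
    have : Set.range (σ.comp (affSimplex v)) ⊆ if b then U else V := by
      rintro _ ⟨t, rfl⟩
      exact hb ((dist_affSimplex_le v hv t).trans_lt hN)
    cases b
    · exact Or.inr (by simpa using this)
    · exact Or.inl (by simpa using this)
  · exact (dist_triangle_right _ _ (stdSimplex.vertex (S := ℝ) 0)).trans
      (add_le_add (hD (Set.mem_univ _)) (hD (Set.mem_univ _)))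

theorem exists_singularSd_mem {U V : Set X} (hU : IsOpen U) (hV : IsOpen V)
    (hUV : U ∪ V = Set.univ) {n : ℕ} (c : (complexSingularChains X).X n) :
    ∃ N, singularSd X N n c ∈ smallChains U V n := by
  have h : ∀ᶠ N in Filter.atTop, ∀ σ ∈ ((singularBasis X n).repr c).support,
      singularSd X N n (singularGen σ) ∈ smallChains U V n :=
    (Filter.eventually_all_finset _).2 fun σ _ => eventually_singularSd_gen_mem hU hV hUV σ
  obtain ⟨N, hN⟩ := h.exists
  refine ⟨N, ?_⟩
  rw [← (singularBasis X n).linearCombination_repr c, Finsupp.linearCombination_apply, Finsupp.sum,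
    map_sum]
  refine Submodule.sum_mem _ fun σ hσ => ?_
  rw [map_smul, singularBasis_apply]
  exact Submodule.smul_mem _ _ (hN σ hσ)

/-- Every chain whose boundary is small is small up to a boundary. -/
theorem exists_sub_d_mem_smallChains {U V : Set X} (hU : IsOpen U) (hV : IsOpen V)
    (hUV : U ∪ V = Set.univ) {n : ℕ} (c : (complexSingularChains X).X n)
    (hc : ∀ k, n = k + 1 → ((complexSingularChains X).d n k).hom c ∈ smallChains U V k) :
    ∃ e : (complexSingularChains X).X (n + 1),
      c - ((complexSingularChains X).d (n + 1) n).hom e ∈ smallChains U V n := by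
  obtain ⟨N, hN⟩ := exists_singularSd_mem hU hV hUV c
  refine ⟨singularSdHomotopy X N n c, ?_⟩
  cases n with
  | zero => rwa [d_singularSdHomotopy_zero, sub_sub_cancel]
  | succ n =>
    -- The first term on the right is small by choice of `N`; the second because the boundary of `c`
    -- is small and the homotopy preserves smallness.
    have : c - ((complexSingularChains X).d (n + 2) (n + 1)).hom (singularSdHomotopy X N (n + 1) c) =
        singularSd X N (n + 1) c +
          singularSdHomotopy X N n (((complexSingularChains X).d (n + 1) n).hom c) := by
      rw [eq_sub_of_add_eq (d_singularSdHomotopy_succ N c)]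
      abel
    rw [this]
    exact add_mem hN (singularSdHomotopy_mem_smallChains N (hc n rfl))

end

/-! ### Euler characteristics of chain complexes -/

/-- The chain complex `C` has finite-dimensional total homology and Euler characteristic `χ`. -/
structure HasEulerChar (C : ChainComplex (ModuleCat.{0} ℂ) ℕ) (χ : ℤ) : Prop where
  finite : ∀ n, Module.Finite ℂ (C.homology n)
  bounded : ∃ N, ∀ n, N ≤ n → Subsingleton (C.homology n)
  eq : C.homologyEulerChar = χ

theorem homologyEulerChar_eq_sum {C : ChainComplex (ModuleCat.{0} ℂ) ℕ} {N : ℕ}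
    (hN : ∀ n, N ≤ n → Subsingleton (C.homology n)) :
    C.homologyEulerChar = ∑ n ∈ Finset.range N, (-1 : ℤ) ^ n * Module.finrank ℂ (C.homology n) := by
  rw [HomologicalComplex.homologyEulerChar_eq_sum_finSet_of_finrankSupport_subset C
    (Finset.range N)]
  · refine Finset.sum_congr rfl fun n _ => ?_
    simp
  · rw [GradedObject.finrankSupport_subset_iff]
    intro n hn
    have := hN n (by simpa using hn)
    exact Module.finrank_zero_of_subsingleton

theorem HasEulerChar.of_isoOnHomology {C D : ChainComplex (ModuleCat.{0} ℂ) ℕ} {χ : ℤ}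
    (h : HasEulerChar C χ) (e : ∀ n, C.homology n ≅ D.homology n) : HasEulerChar D χ where
  finite n := have := h.finite n; Module.Finite.equiv (e n).toLinearEquiv
  bounded := h.bounded.imp fun N hN n hn =>
    have : Subsingleton (C.homology n) := hN n hn; (e n).toLinearEquiv.symm.toEquiv.subsingleton
  eq := by
    obtain ⟨N, hN⟩ := h.bounded
    rw [← h.eq, homologyEulerChar_eq_sum hN, homologyEulerChar_eq_sum (C := D) (N := N) fun n hn =>
      have := hN n hn; (e n).toLinearEquiv.symm.toEquiv.subsingleton]
    exact Finset.sum_congr rfl fun n _ => by rw [(e n).toLinearEquiv.finrank_eq]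

theorem HasEulerChar.of_acyclic {C : ChainComplex (ModuleCat.{0} ℂ) ℕ}
    (h : ∀ n, C.ExactAt n) : HasEulerChar C 0 := by
  have h' : ∀ n, Subsingleton (C.homology n) := fun n =>
    ModuleCat.subsingleton_of_isZero (h n).isZero_homology
  refine ⟨fun n => ?_, ⟨0, fun n _ => h' n⟩, ?_⟩
  · have := h' n
    infer_instance
  · rw [homologyEulerChar_eq_sum (N := 0) fun n _ => h' n]
    simp

theorem Module.Finite.of_finite_ker {M N : Type} [AddCommGroup M] [Module ℂ M] [AddCommGroup N]
    [Module ℂ N] (f : M →ₗ[ℂ] N) [Module.Finite ℂ N] [Module.Finite ℂ (LinearMap.ker f)] :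
    Module.Finite ℂ M := by
  have : Module.Finite ℂ (M ⧸ LinearMap.ker f) := Module.Finite.equiv f.quotKerEquivRange.symm
  exact Module.Finite.of_submodule_quotient (LinearMap.ker f)

section LongExact

variable {a b c : ℕ → Type} [∀ n, AddCommGroup (a n)] [∀ n, Module ℂ (a n)]
  [∀ n, AddCommGroup (b n)] [∀ n, Module ℂ (b n)] [∀ n, AddCommGroup (c n)] [∀ n, Module ℂ (c n)]

/-- Rank–nullity at each term, with exactness identifying kernels and images. Cutting off at `N`
leaves exactly one uncancelled rank, that of the connecting map into `a N`. -/
theorem alternating_sum_longExact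
    [∀ n, Module.Finite ℂ (a n)] [∀ n, Module.Finite ℂ (b n)] [∀ n, Module.Finite ℂ (c n)]
    (f : ∀ n, a n →ₗ[ℂ] b n) (g : ∀ n, b n →ₗ[ℂ] c n) (δ : ∀ n, c (n + 1) →ₗ[ℂ] a n)
    (hfg : ∀ n, LinearMap.range (f n) = LinearMap.ker (g n))
    (hgδ : ∀ n, LinearMap.range (g (n + 1)) = LinearMap.ker (δ n))
    (hδf : ∀ n, LinearMap.range (δ n) = LinearMap.ker (f n))
    (hg0 : LinearMap.range (g 0) = ⊤) (N : ℕ) :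
    ∑ n ∈ Finset.range (N + 1), (-1 : ℤ) ^ n * Module.finrank ℂ (b n) =
      ∑ n ∈ Finset.range (N + 1), (-1 : ℤ) ^ n * Module.finrank ℂ (a n) +
      ∑ n ∈ Finset.range (N + 1), (-1 : ℤ) ^ n * Module.finrank ℂ (c n) -
      (-1 : ℤ) ^ N * Module.finrank ℂ (LinearMap.range (δ N)) := by
  have ha (n) := LinearMap.finrank_range_add_finrank_ker (f n)
  have hb (n) := LinearMap.finrank_range_add_finrank_ker (g n)
  have hc (n) := LinearMap.finrank_range_add_finrank_ker (δ n)
  induction N with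
  | zero =>
    have h1 := ha 0
    have h2 := hb 0
    rw [← hδf] at h1
    rw [← hfg, hg0, finrank_top] at h2
    simp only [zero_add, Finset.sum_range_one, pow_zero, one_mul]
    omega
  | succ N ih =>
    have h1 := ha (N + 1)
    have h2 := hb (N + 1)
    have h3 := hc N
    rw [← hδf] at h1
    rw [← hfg] at h2
    rw [← hgδ] at h3
    rw [Finset.sum_range_succ, ih, Finset.sum_range_succ _ (N + 1), Finset.sum_range_succ _ (N + 1),
      pow_succ, ← h1, ← h2, ← h3]
    push_cast
    ring

end LongExact

namespace CategoryTheory.ShortComplex.ShortExact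

variable {S : ShortComplex (ChainComplex (ModuleCat.{0} ℂ) ℕ)} (hS : S.ShortExact)
include hS

theorem range_homologyMap_f (n : ℕ) :
    LinearMap.range (HomologicalComplex.homologyMap S.f n).hom =
      LinearMap.ker (HomologicalComplex.homologyMap S.g n).hom :=
  (hS.homology_exact₂ n).moduleCat_range_eq_ker

theorem range_homologyMap_g (n : ℕ) :
    LinearMap.range (HomologicalComplex.homologyMap S.g (n + 1)).hom =
      LinearMap.ker (hS.δ (n + 1) n rfl).hom :=
  (hS.homology_exact₃ (n + 1) n rfl).moduleCat_range_eq_ker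

theorem range_δ (n : ℕ) :
    LinearMap.range (hS.δ (n + 1) n rfl).hom =
      LinearMap.ker (HomologicalComplex.homologyMap S.f n).hom :=
  (hS.homology_exact₁ (n + 1) n rfl).moduleCat_range_eq_ker

theorem range_homologyMap_g_zero :
    LinearMap.range (HomologicalComplex.homologyMap S.g 0).hom = ⊤ := by
  have := hS.epi_g
  have : Epi (S.g.f 0) := inferInstance
  have := HomologicalComplex.epi_homologyMap_of_epi_of_not_rel S.g 0 (by simp)
  exact LinearMap.range_eq_top.2 ((ModuleCat.epi_iff_surjective _).1 this)

/-- The sums are cut at `N + 1` rather than `N`, so that the leftover connecting map lands in the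
vanishing space `H_N` of the first complex. -/
theorem homologyEulerChar_eq {N : ℕ}
    (h1 : ∀ n, Module.Finite ℂ (S.X₁.homology n)) (h2 : ∀ n, Module.Finite ℂ (S.X₂.homology n))
    (h3 : ∀ n, Module.Finite ℂ (S.X₃.homology n))
    (h1' : ∀ n, N ≤ n → Subsingleton (S.X₁.homology n))
    (h2' : ∀ n, N ≤ n → Subsingleton (S.X₂.homology n))
    (h3' : ∀ n, N ≤ n → Subsingleton (S.X₃.homology n)) :
    S.X₂.homologyEulerChar = S.X₁.homologyEulerChar + S.X₃.homologyEulerChar := by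
  rw [homologyEulerChar_eq_sum (N := N + 1) fun n hn => h1' n (by omega),
    homologyEulerChar_eq_sum (N := N + 1) fun n hn => h2' n (by omega),
    homologyEulerChar_eq_sum (N := N + 1) fun n hn => h3' n (by omega)]
  rw [alternating_sum_longExact (fun n => (HomologicalComplex.homologyMap S.f n).hom)
    (fun n => (HomologicalComplex.homologyMap S.g n).hom) (fun n => (hS.δ (n + 1) n rfl).hom)
    hS.range_homologyMap_f hS.range_homologyMap_g hS.range_δ hS.range_homologyMap_g_zero]
  have := h1' N le_rfl
  have h0 : Module.finrank ℂ (LinearMap.range (hS.δ (N + 1) N rfl).hom) = 0 :=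
    Module.finrank_zero_of_subsingleton
  rw [h0]
  simp

theorem hasEulerChar_middle {x z : ℤ} (h1 : HasEulerChar S.X₁ x) (h3 : HasEulerChar S.X₃ z) :
    HasEulerChar S.X₂ (x + z) := by
  obtain ⟨N₁, hN₁⟩ := h1.bounded
  obtain ⟨N₃, hN₃⟩ := h3.bounded
  have hfin : ∀ n, Module.Finite ℂ (S.X₂.homology n) := fun n => by
    have := h1.finite n
    have := h3.finite n
    have : FiniteDimensional ℂ (LinearMap.ker (HomologicalComplex.homologyMap S.g n).hom) := by
      rw [← hS.range_homologyMap_f]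
      infer_instance
    exact Module.Finite.of_finite_ker (HomologicalComplex.homologyMap S.g n).hom
  have hsub : ∀ n, max N₁ N₃ ≤ n → Subsingleton (S.X₂.homology n) := fun n hn => by
    have := hN₁ n (by omega)
    have := hN₃ n (by omega)
    refine subsingleton_of_forall_eq 0 fun y => ?_
    have hy : y ∈ LinearMap.ker (HomologicalComplex.homologyMap S.g n).hom :=
      Subsingleton.elim _ _
    rw [← hS.range_homologyMap_f] at hy
    obtain ⟨x, rfl⟩ := hy
    rw [Subsingleton.elim x 0, map_zero]
  exact ⟨hfin, ⟨_, hsub⟩, by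
    rw [hS.homologyEulerChar_eq (N := max N₁ N₃) h1.finite hfin h3.finite
      (fun n hn => hN₁ n (by omega)) hsub (fun n hn => hN₃ n (by omega)), h1.eq, h3.eq]⟩

theorem hasEulerChar_right {x y : ℤ} (h1 : HasEulerChar S.X₁ x) (h2 : HasEulerChar S.X₂ y) :
    HasEulerChar S.X₃ (y - x) := by
  obtain ⟨N₁, hN₁⟩ := h1.bounded
  obtain ⟨N₂, hN₂⟩ := h2.bounded
  have hfin : ∀ n, Module.Finite ℂ (S.X₃.homology n) := fun n => by
    cases n with
    | zero =>
      have := h2.finite 0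
      exact Module.Finite.of_surjective _ (LinearMap.range_eq_top.1 hS.range_homologyMap_g_zero)
    | succ n =>
      have := h2.finite (n + 1)
      have := h1.finite n
      have : FiniteDimensional ℂ (LinearMap.ker (hS.δ (n + 1) n rfl).hom) := by
        rw [← hS.range_homologyMap_g]
        infer_instance
      exact Module.Finite.of_finite_ker (hS.δ (n + 1) n rfl).hom
  -- The connecting map lowers the degree, so vanishing for the first complex is inherited one
  -- degree higher.
  have hsub : ∀ n, max (N₁ + 1) N₂ ≤ n → Subsingleton (S.X₃.homology n) := fun n hn => by
    obtain ⟨n, rfl⟩ : ∃ k, n = k + 1 := ⟨n - 1, by omega⟩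
    have := hN₁ n (by omega)
    have := hN₂ (n + 1) (by omega)
    refine subsingleton_of_forall_eq 0 fun y => ?_
    have hy : y ∈ LinearMap.ker (hS.δ (n + 1) n rfl).hom := Subsingleton.elim _ _
    rw [← hS.range_homologyMap_g] at hy
    obtain ⟨x, rfl⟩ := hy
    rw [Subsingleton.elim x 0, map_zero]
  refine ⟨hfin, ⟨_, hsub⟩, ?_⟩
  have := hS.homologyEulerChar_eq (N := max (N₁ + 1) N₂) h1.finite h2.finite hfin
      (fun n hn => hN₁ n (by omega)) (fun n hn => hN₂ n (by omega)) hsub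
  rw [h1.eq, h2.eq] at this
  linarith

end CategoryTheory.ShortComplex.ShortExact

theorem HasEulerChar.biprod {C D : ChainComplex (ModuleCat.{0} ℂ) ℕ} {x y : ℤ}
    (hC : HasEulerChar C x) (hD : HasEulerChar D y) : HasEulerChar (C ⊞ D) (x + y) := by
  have hS : (ShortComplex.mk (Limits.biprod.inl : C ⟶ C ⊞ D) Limits.biprod.snd (by simp)).ShortExact :=
    (ShortComplex.Splitting.ofHasBinaryBiproduct C D).shortExact
  exact hS.hasEulerChar_middle hC hD

/-- Euler characteristics in an exact sequence `0 ⟶ A ⟶ B ⟶ C` whose last map has acyclic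
cokernel. -/
theorem HasEulerChar.of_exact {A B C : ChainComplex (ModuleCat.{0} ℂ) ℕ} {x y : ℤ}
    (f : A ⟶ B) (g : B ⟶ C) (hfg : f ≫ g = 0)
    (hf : ∀ n, Function.Injective (f.f n).hom)
    (hex : ∀ n b, (g.f n).hom b = 0 → ∃ a, (f.f n).hom a = b)
    (hac : ∀ n c, (∀ k, n = k + 1 → (C.d n k).hom c ∈ LinearMap.range (g.f k).hom) →
      ∃ e, c - (C.d (n + 1) n).hom e ∈ LinearMap.range (g.f n).hom)
    (hA : HasEulerChar A x) (hB : HasEulerChar B y) : HasEulerChar C (y - x) := by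
  have hfm : Mono f := by
    have : ∀ n, Mono (f.f n) := fun n => (ModuleCat.mono_iff_injective _).2 (hf n)
    exact HomologicalComplex.mono_of_mono_f _ this
  have hE : (ShortComplex.mk f g hfg).Exact := by
    refine HomologicalComplex.exact_of_degreewise_exact _ fun n => ?_
    exact (ShortComplex.moduleCat_exact_iff _).2 (hex n)
  -- By exactness `B / A` embeds in `C` as the image of `g`. So `C` is an extension of an acyclic
  -- quotient by `B / A`, and two short exact sequences give the count.
  have hmono := hE.mono_cokernelDesc
  set h : Limits.cokernel f ⟶ C := Limits.cokernel.desc f g hfg with hh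
  have hS1 : (ShortComplex.mk f (Limits.cokernel.π f) (by simp)).ShortExact :=
    { exact := ShortComplex.exact_cokernel f }
  have hS2 : (ShortComplex.mk h (Limits.cokernel.π h) (by simp)).ShortExact :=
    { exact := ShortComplex.exact_cokernel h }
  have hI := hS1.hasEulerChar_right hA hB
  have hQ : HasEulerChar (Limits.cokernel h) 0 := by
    refine HasEulerChar.of_acyclic fun n => ?_
    have hπ : ∀ n, Function.Surjective ((Limits.cokernel.π h).f n).hom := fun n =>
      (ModuleCat.epi_iff_surjective _).1 inferInstance
    have hker : ∀ n c, ((Limits.cokernel.π h).f n).hom c = 0 ↔ c ∈ LinearMap.range (g.f n).hom := by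
      intro n c
      have hdeg := (HomologicalComplex.exact_iff_degreewise_exact _).1 hS2.exact n
      have hg : g.f n = (Limits.cokernel.π f).f n ≫ h.f n := by
        rw [← HomologicalComplex.comp_f, Limits.cokernel.π_desc]
      have hs : Function.Surjective ((Limits.cokernel.π f).f n).hom :=
        (ModuleCat.epi_iff_surjective _).1 inferInstance
      constructor
      · intro hc
        obtain ⟨q, hq⟩ := (ShortComplex.moduleCat_exact_iff _).1 hdeg c hc
        obtain ⟨b, rfl⟩ := hs q
        refine ⟨b, ?_⟩
        rw [hg]
        exact hq
      · rintro ⟨b, rfl⟩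
        have hz : g.f n ≫ (Limits.cokernel.π h).f n = 0 := by
          rw [hg, Category.assoc, ← HomologicalComplex.comp_f, Limits.cokernel.condition]
          simp
        exact congrArg (fun φ => φ.hom b) hz
    have hcomm : ∀ i j c, ((Limits.cokernel.π h).f j).hom ((C.d i j).hom c) =
        ((Limits.cokernel h).d i j).hom (((Limits.cokernel.π h).f i).hom c) := fun i j c =>
      (congrArg (fun φ => φ.hom c) ((Limits.cokernel.π h).comm i j)).symm
    -- At `n = 0` truncated subtraction gives the index `0`, where the differential vanishes; the
    -- boundary condition in `hac` is then vacuous.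
    rw [HomologicalComplex.exactAt_iff' _ (n + 1) n (n - 1) (by simp) (by cases n <;> simp),
      ShortComplex.moduleCat_exact_iff]
    intro q hq
    obtain ⟨c, rfl⟩ := hπ n q
    obtain ⟨e, he⟩ := hac n c (by
      rintro k rfl
      rw [← hker, hcomm]
      exact hq)
    refine ⟨((Limits.cokernel.π h).f (n + 1)).hom e, ?_⟩
    have := (hker _ _).2 he
    rw [map_sub, sub_eq_zero, hcomm] at this
    exact this.symm
  have := hS2.hasEulerChar_middle hI hQ
  rwa [add_zero] at this

/-! ### Homotopy invariance and discrete spaces -/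

/-- The space `X` has finite-dimensional total homology and Euler characteristic `χ`. -/
abbrev HasTopEulerChar (X : Type) [TopologicalSpace X] (χ : ℤ) : Prop :=
  HasEulerChar (complexSingularChains X) χ

theorem HasTopEulerChar.hasFiniteTotalHomology {X : Type} [TopologicalSpace X] {χ : ℤ}
    (h : HasTopEulerChar X χ) : HasFiniteTotalHomology X := ⟨h.finite, h.bounded⟩

theorem HasTopEulerChar.eulerCharacteristic_eq {X : Type} [TopologicalSpace X] {χ : ℤ}
    (h : HasTopEulerChar X χ) : eulerCharacteristic X = χ := h.eq

theorem HasTopEulerChar.unique {X : Type} [TopologicalSpace X] {χ χ' : ℤ}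
    (h : HasTopEulerChar X χ) (h' : HasTopEulerChar X χ') : χ = χ' := h.eq.symm.trans h'.eq

theorem singularMap_homotopic {X Y : Type} [TopologicalSpace X] [TopologicalSpace Y]
    {f g : C(X, Y)} (h : f.Homotopic g) (n : ℕ) :
    HomologicalComplex.homologyMap (singularMap f) n =
      HomologicalComplex.homologyMap (singularMap g) n := by
  obtain ⟨H⟩ := h
  exact TopCat.Homotopy.congr_homologyMap_singularChainComplexFunctor
    (f := TopCat.ofHom f) (g := TopCat.ofHom g) H (ModuleCat.of ℂ ℂ) n

/-- Maps which are inverse to each other up to homotopy preserve the Euler characteristic. -/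
theorem HasTopEulerChar.of_homotopyInverse {X Y : Type} [TopologicalSpace X] [TopologicalSpace Y]
    {χ : ℤ} (h : HasTopEulerChar X χ) (f : C(X, Y)) (g : C(Y, X))
    (hgf : (g.comp f).Homotopic (ContinuousMap.id X))
    (hfg : (f.comp g).Homotopic (ContinuousMap.id Y)) : HasTopEulerChar Y χ := by
  refine HasEulerChar.of_isoOnHomology h fun n =>
    ⟨HomologicalComplex.homologyMap (singularMap f) n,
      HomologicalComplex.homologyMap (singularMap g) n, ?_, ?_⟩
  · rw [← HomologicalComplex.homologyMap_comp, ← singularMap_comp, singularMap_homotopic hgf,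
      singularMap_id, HomologicalComplex.homologyMap_id]
  · rw [← HomologicalComplex.homologyMap_comp, ← singularMap_comp, singularMap_homotopic hfg,
      singularMap_id, HomologicalComplex.homologyMap_id]

theorem HasTopEulerChar.of_homeomorph {X Y : Type} [TopologicalSpace X] [TopologicalSpace Y]
    {χ : ℤ} (h : HasTopEulerChar X χ) (e : X ≃ₜ Y) : HasTopEulerChar Y χ :=
  h.of_homotopyInverse ⟨e, e.continuous⟩ ⟨e.symm, e.symm.continuous⟩
    (by
      convert ContinuousMap.Homotopic.refl _
      ext x
      exact (e.symm_apply_apply x).symm)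
    (by
      convert ContinuousMap.Homotopic.refl _
      ext x
      exact (e.apply_symm_apply x).symm)

theorem hasTopEulerChar_of_discrete (X : Type) [TopologicalSpace X] [DiscreteTopology X]
    [Finite X] : HasTopEulerChar X (Nat.card X) := by
  have := Fintype.ofFinite X
  have hpos : ∀ n, n ≠ 0 → Subsingleton ((complexSingularChains X).homology n) := fun n hn =>
    ModuleCat.subsingleton_of_isZero (singularChainComplexFunctor_exactAt_of_totallyDisconnectedSpace
      (ModuleCat.{0} ℂ) n (ModuleCat.of ℂ ℂ) (TopCat.of X) hn).isZero_homology
  have e : (complexSingularChains X).homology 0 ≃ₗ[ℂ] (X → ℂ) :=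
    (singularHomologyFunctorZeroOfTotallyDisconnectedSpace (ModuleCat.{0} ℂ) (ModuleCat.of ℂ ℂ)
      (TopCat.of X) ≪≫ (Limits.biproduct.isoCoproduct _).symm ≪≫
        ModuleCat.biproductIsoPi (fun _ : X => ModuleCat.of ℂ ℂ)).toLinearEquiv
  refine ⟨fun n => ?_, ⟨1, fun n hn => hpos n (by omega)⟩, ?_⟩
  · by_cases hn : n = 0
    · subst hn
      exact Module.Finite.equiv e.symm
    · have := hpos n hn
      infer_instance
  · rw [homologyEulerChar_eq_sum (N := 1) fun n hn => hpos n (by omega)]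
    rw [Finset.sum_range_one, e.finrank_eq, Module.finrank_pi, Nat.card_eq_fintype_card]
    simp

/-! ### The Mayer–Vietoris formula -/

section MayerVietoris

variable {X : Type} [TopologicalSpace X]

theorem singularMap_injective {Y : Type} [TopologicalSpace Y] {f : C(X, Y)}
    (hf : Function.Injective f) (n : ℕ) : Function.Injective ((singularMap f).f n).hom := by
  have h : ((singularMap f).f n).hom = ((singularBasis Y n).repr.symm.toLinearMap ∘ₗ
      Finsupp.lmapDomain ℂ ℂ f.comp) ∘ₗ (singularBasis X n).repr.toLinearMap := by
    refine (singularBasis X n).ext fun σ => ?_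
    have : (singularBasis X n).repr (singularGen σ) = Finsupp.single σ 1 := by
      rw [← singularBasis_apply, Module.Basis.repr_self]
    simp [singularMap_gen, this]
  rw [h]
  refine ((singularBasis Y n).repr.symm.injective.comp ?_).comp (singularBasis X n).repr.injective
  refine Finsupp.mapDomain_injective fun σ τ hστ => ?_
  ext t
  exact hf (congrArg (fun φ => φ t) hστ)

theorem range_singularMap_subtype (S : Set X) (n : ℕ) :
    LinearMap.range ((singularMap (⟨Subtype.val, continuous_subtype_val⟩ : C(S, X))).f n).hom =
      Submodule.span ℂ (singularGen '' {σ | Set.range σ ⊆ S}) := by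
  rw [LinearMap.range_eq_map, ← (singularBasis S n).span_eq, Submodule.map_span]
  congr 1
  ext c
  constructor
  · rintro ⟨_, ⟨σ, rfl⟩, rfl⟩
    refine ⟨(⟨Subtype.val, continuous_subtype_val⟩ : C(S, X)).comp σ, ?_, ?_⟩
    · rintro _ ⟨t, rfl⟩
      exact (σ t).2
    · rw [singularBasis_apply]
      exact (singularMap_gen _ _).symm
  · rintro ⟨σ, hσ, rfl⟩
    refine ⟨_, ⟨⟨fun t => ⟨σ t, hσ ⟨t, rfl⟩⟩, σ.continuous.subtype_mk _⟩, rfl⟩, ?_⟩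
    rw [singularBasis_apply]
    exact singularMap_gen _ _

/-- Simplices form a basis, so membership in such a span is a condition on the support, and these
conditions intersect. -/
theorem span_singularGen_inf {n : ℕ} (A B : Set C(stdSimplex ℝ (Fin (n + 1)), X)) :
    Submodule.span ℂ (singularGen '' A) ⊓ Submodule.span ℂ (singularGen '' B) ≤
      Submodule.span ℂ (singularGen '' (A ∩ B)) := by
  have h : (singularGen (X := X) (n := n)) = singularBasis X n :=
    funext fun σ => (singularBasis_apply X n σ).symm
  rintro c ⟨hA, hB⟩
  rw [h, SetLike.mem_coe, Module.Basis.mem_span_image] at hA hB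
  rw [h, Module.Basis.mem_span_image]
  exact Set.subset_inter hA hB

/-- The Mayer–Vietoris formula for the Euler characteristic of an open cover. -/
theorem HasTopEulerChar.of_cover {U V : Set X} (hU : IsOpen U) (hV : IsOpen V)
    (hUV : U ∪ V = Set.univ) {x y z : ℤ} (hx : HasTopEulerChar U x) (hy : HasTopEulerChar V y)
    (hz : HasTopEulerChar ↥(U ∩ V) z) : HasTopEulerChar X (x + y - z) := by
  let u : C(U, X) := ⟨Subtype.val, continuous_subtype_val⟩
  let v : C(V, X) := ⟨Subtype.val, continuous_subtype_val⟩
  let w : C(↥(U ∩ V), X) := ⟨Subtype.val, continuous_subtype_val⟩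
  let i : C(↥(U ∩ V), U) := ⟨Set.inclusion Set.inter_subset_left, continuous_inclusion _⟩
  let j : C(↥(U ∩ V), V) := ⟨Set.inclusion Set.inter_subset_right, continuous_inclusion _⟩
  have hui : singularMap i ≫ singularMap u = singularMap w := (singularMap_comp u i).symm
  have hvj : singularMap j ≫ singularMap v = singularMap w := (singularMap_comp v j).symm
  -- The sign makes the composite with the sum map `g` vanish.
  set f := Limits.biprod.lift (singularMap i) (-singularMap j) with hf
  set g := Limits.biprod.desc (singularMap u) (singularMap v) with hg
  let p₁ : complexSingularChains U ⊞ complexSingularChains V ⟶ complexSingularChains U :=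
    Limits.biprod.fst
  let p₂ : complexSingularChains U ⊞ complexSingularChains V ⟶ complexSingularChains V :=
    Limits.biprod.snd
  let i₁ : complexSingularChains U ⟶ complexSingularChains U ⊞ complexSingularChains V :=
    Limits.biprod.inl
  let i₂ : complexSingularChains V ⟶ complexSingularChains U ⊞ complexSingularChains V :=
    Limits.biprod.inr
  have hfst : ∀ n a, (p₁.f n).hom ((f.f n).hom a) = ((singularMap i).f n).hom a := fun n a =>
    congrArg (fun φ : complexSingularChains ↥(U ∩ V) ⟶ _ => (φ.f n).hom a)
      (Limits.biprod.lift_fst _ _)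
  have hsnd : ∀ n a, (p₂.f n).hom ((f.f n).hom a) = -((singularMap j).f n).hom a := fun n a =>
    congrArg (fun φ : complexSingularChains ↥(U ∩ V) ⟶ _ => (φ.f n).hom a)
      (Limits.biprod.lift_snd _ _)
  have htotal : ∀ n (b : (complexSingularChains U ⊞ complexSingularChains V).X n),
      (i₁.f n).hom ((p₁.f n).hom b) + (i₂.f n).hom ((p₂.f n).hom b) = b := fun n b =>
    congrArg (fun φ : complexSingularChains U ⊞ complexSingularChains V ⟶ _ => (φ.f n).hom b)
      Limits.biprod.total
  have hgl : ∀ n a, (g.f n).hom ((i₁.f n).hom a) = ((singularMap u).f n).hom a :=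
    fun n a => congrArg (fun φ : complexSingularChains U ⟶ _ => (φ.f n).hom a)
      (Limits.biprod.inl_desc _ _)
  have hgr : ∀ n a, (g.f n).hom ((i₂.f n).hom a) = ((singularMap v).f n).hom a :=
    fun n a => congrArg (fun φ : complexSingularChains V ⟶ _ => (φ.f n).hom a)
      (Limits.biprod.inr_desc _ _)
  have hrange : ∀ n, LinearMap.range (g.f n).hom = smallChains U V n := by
    intro n
    have h1 : smallChains U V n = LinearMap.range ((singularMap u).f n).hom ⊔
        LinearMap.range ((singularMap v).f n).hom := by
      rw [range_singularMap_subtype, range_singularMap_subtype, ← Submodule.span_union,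
        ← Set.image_union]
      rfl
    rw [h1]
    apply le_antisymm
    · rintro _ ⟨b, rfl⟩
      rw [← htotal n b, map_add, hgl, hgr]
      exact Submodule.add_mem_sup ⟨_, rfl⟩ ⟨_, rfl⟩
    · refine sup_le ?_ ?_
      · rintro _ ⟨a, rfl⟩
        exact ⟨_, hgl n a⟩
      · rintro _ ⟨a, rfl⟩
        exact ⟨_, hgr n a⟩
  refine HasEulerChar.of_exact f g ?_ ?_ ?_ ?_ hz (hx.biprod hy)
  · rw [hf, hg, Limits.biprod.lift_desc, Preadditive.neg_comp, hui, hvj, add_neg_cancel]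
  · intro n a b hab
    have := congrArg (p₁.f n).hom hab
    rw [hfst, hfst] at this
    exact singularMap_injective (f := i) (Set.inclusion_injective Set.inter_subset_left) n this
  · intro n b hb
    rw [← htotal n b, map_add, hgl, hgr] at hb
    set p := (p₁.f n).hom b
    set q := (p₂.f n).hom b
    -- If `p + q = 0` in `X`, the common chain `p = -q` is supported both in `U` and in `V`, hence
    -- comes from `U ∩ V`.
    have hp : ((singularMap u).f n).hom p ∈ LinearMap.range ((singularMap w).f n).hom := by
      rw [range_singularMap_subtype]
      have h1 : {σ : C(stdSimplex ℝ (Fin (n + 1)), X) | Set.range σ ⊆ U ∩ V} =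
          {σ : C(stdSimplex ℝ (Fin (n + 1)), X) | Set.range σ ⊆ U} ∩
          {σ : C(stdSimplex ℝ (Fin (n + 1)), X) | Set.range σ ⊆ V} := by
        ext σ
        exact Set.subset_inter_iff
      rw [h1]
      refine span_singularGen_inf _ _ ⟨?_, ?_⟩
      · rw [SetLike.mem_coe, ← range_singularMap_subtype]
        exact ⟨p, rfl⟩
      · rw [SetLike.mem_coe, ← range_singularMap_subtype, eq_neg_of_add_eq_zero_left hb]
        exact neg_mem ⟨q, rfl⟩
    obtain ⟨a, ha⟩ := hp
    have hw1 : ((singularMap w).f n).hom a = ((singularMap u).f n).hom (((singularMap i).f n).hom a) :=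
      congrArg (fun φ : complexSingularChains ↥(U ∩ V) ⟶ _ => (φ.f n).hom a) hui.symm
    have hw2 : ((singularMap w).f n).hom a = ((singularMap v).f n).hom (((singularMap j).f n).hom a) :=
      congrArg (fun φ : complexSingularChains ↥(U ∩ V) ⟶ _ => (φ.f n).hom a) hvj.symm
    have hpa : ((singularMap i).f n).hom a = p :=
      singularMap_injective Subtype.val_injective n (hw1.symm.trans ha)
    have hqa : -((singularMap j).f n).hom a = q := by
      refine singularMap_injective (f := v) Subtype.val_injective n ?_
      rw [map_neg, ← hw2, ha, eq_neg_of_add_eq_zero_left hb, neg_neg]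
    refine ⟨a, ?_⟩
    rw [← htotal n ((f.f n).hom a), hfst, hsnd, hpa, hqa, htotal]
  · intro n c hc
    rw [hrange]
    -- The image of `g` is the complex of small chains; subdivision makes its cokernel acyclic.
    refine exists_sub_d_mem_smallChains hU hV hUV c fun k hk => ?_
    rw [← hrange]
    exact hc k hk

/-- The homeomorphism from a subset of a subspace to its image. -/
def Set.homeomorphPreimageVal {S T : Set X} (h : T ⊆ S) :
    ((Subtype.val : S → X) ⁻¹' T) ≃ₜ T where
  toFun x := ⟨x.1.1, x.2⟩
  invFun x := ⟨⟨x.1, h x.2⟩, x.2⟩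
  left_inv _ := rfl
  right_inv _ := rfl
  continuous_toFun := by fun_prop
  continuous_invFun := by fun_prop

/-- The Mayer–Vietoris formula for the Euler characteristic of a union of open sets. -/
theorem HasTopEulerChar.union {U V : Set X} (hU : IsOpen U) (hV : IsOpen V)
    {x y z : ℤ} (hx : HasTopEulerChar U x) (hy : HasTopEulerChar V y)
    (hz : HasTopEulerChar ↥(U ∩ V) z) : HasTopEulerChar ↥(U ∪ V) (x + y - z) :=
  HasTopEulerChar.of_cover (U := Subtype.val ⁻¹' U) (V := Subtype.val ⁻¹' V)
    (hU.preimage continuous_subtype_val) (hV.preimage continuous_subtype_val)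
    (by ext p; exact iff_true_intro p.2)
    (hx.of_homeomorph (Set.homeomorphPreimageVal Set.subset_union_left).symm)
    (hy.of_homeomorph (Set.homeomorphPreimageVal Set.subset_union_right).symm)
    (hz.of_homeomorph (Set.homeomorphPreimageVal (T := U ∩ V)
      (Set.inter_subset_left.trans Set.subset_union_left)).symm)

end MayerVietoris

/-! ### Finite coverings over unions of convex open sets -/

section Covering

/-- The identity as a one-sheeted covering turns statements about coverings into statements about
the base. -/
theorem isCoveringMap_refl (X : Type*) [TopologicalSpace X] : IsCoveringMap (fun x : X => x) :=
  fun _ => IsEvenlyCovered.to_isEvenlyCovered_preimage (I := PUnit.{1})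
    ⟨inferInstance, Set.univ, trivial, isOpen_univ, isOpen_univ,
      (Homeomorph.prodPUnit _).symm, fun _ => rfl⟩

open unitInterval

variable {W : Type} [AddCommGroup W] [Module ℝ W] [TopologicalSpace W] [ContinuousAdd W]
  [ContinuousSMul ℝ W] {B : Set W} {E : Type} [TopologicalSpace E] {p : E → B}

/-- The part of a covering space over a convex set has the homotopy type of a fiber. -/
theorem IsCoveringMap.hasTopEulerChar_convex (cov : IsCoveringMap p) {n : ℕ}
    (hfin : ∀ b, Finite (p ⁻¹' {b})) (hcard : ∀ b, Nat.card (p ⁻¹' {b}) = n)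
    {S : Set W} (hS : Convex ℝ S) (hne : S.Nonempty) (hSB : S ⊆ B) :
    HasTopEulerChar ↥{e : E | (p e : W) ∈ S} n := by
  obtain ⟨s, hs⟩ := hne
  let T := {e : E | (p e : W) ∈ S}
  have hmem : ∀ (t : I) (e : T), (1 - (t : ℝ)) • (p e : W) + (t : ℝ) • s ∈ S := fun t e =>
    hS e.2 hs (sub_nonneg.2 t.2.2) t.2.1 (sub_add_cancel _ _)
  -- The straight-line contraction of `S` to `s`, precomposed with `p`. Its lift starting at the
  -- inclusion moves the part over `S` into the fiber over `s`.
  let H : C(I × T, B) :=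
    ⟨fun x => ⟨(1 - (x.1 : ℝ)) • (p x.2 : W) + (x.1 : ℝ) • s, hSB (hmem _ _)⟩, by
      have := cov.continuous
      refine Continuous.subtype_mk ?_ _
      fun_prop⟩
  let i₀ : C(T, E) := ⟨Subtype.val, continuous_subtype_val⟩
  have H0 : ∀ a, H (0, a) = p (i₀ a) := fun a => Subtype.ext (by simp [H, i₀])
  let L := cov.liftHomotopy H i₀ H0
  have hL : ∀ x, p (L x) = H x := fun x => congrFun (cov.liftHomotopy_lifts H i₀ H0) x
  have hL0 : ∀ a, L (0, a) = a.1 := fun a => cov.liftHomotopy_zero H i₀ H0 a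
  let b : B := ⟨s, hSB hs⟩
  let F := p ⁻¹' {b}
  have hFdisc : DiscreteTopology F := (cov b).discreteTopology_fiber
  have := hfin b
  have hF : HasTopEulerChar F n := by
    have := hasTopEulerChar_of_discrete F
    rwa [hcard b] at this
  have hFT : F ⊆ T := fun e he => by
    have : p e = b := he
    change (p e : W) ∈ S
    rw [this]
    exact hs
  let i : C(F, T) := ⟨Set.inclusion hFT, continuous_inclusion _⟩
  let r : C(T, F) := ⟨fun e => ⟨L (1, e), (hL _).trans (Subtype.ext (by simp [H, b]))⟩, by
    refine Continuous.subtype_mk ?_ _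
    fun_prop⟩
  refine hF.of_homotopyInverse i r ?_ ?_
  · have hri : r.comp i = ContinuousMap.id F := by
      ext e
      change L (1, i e) = e.1
      have hb : (p e.1 : W) = s := congrArg Subtype.val e.2
      -- Over `s` the contraction is constant, and a lift of a constant path is constant; so the
      -- fiber stays fixed.
      have hc := cov.const_of_comp (g := fun t : I => L (t, i e)) (by fun_prop)
        (fun t t' => by
          rw [hL, hL]
          refine Subtype.ext ?_
          change (1 - (t : ℝ)) • (p e.1 : W) + (t : ℝ) • s =
            (1 - (t' : ℝ)) • (p e.1 : W) + (t' : ℝ) • s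
          rw [hb, ← add_smul, ← add_smul, sub_add_cancel, sub_add_cancel]) 1 0
      exact hc.trans (hL0 _)
    rw [hri]
  · have hLT : ∀ x, (p (L x) : W) ∈ S := fun x => by
      rw [hL]
      exact hmem _ _
    refine ContinuousMap.Homotopic.symm ⟨⟨⟨fun x => ⟨L x, hLT x⟩, ?_⟩, ?_, ?_⟩⟩
    · exact Continuous.subtype_mk L.continuous _
    · intro e
      exact Subtype.ext (hL0 e)
    · intro e
      rfl

theorem hasTopEulerChar_convex {S : Set W} (hS : Convex ℝ S) (hne : S.Nonempty) :
    HasTopEulerChar S 1 := by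
  have h := (isCoveringMap_refl S).hasTopEulerChar_convex (n := 1)
    (fun b => (inferInstance : Finite ({b} : Set S)))
    (fun b => (Set.ncard_singleton b : Nat.card ({b} : Set S) = 1)) hS hne le_rfl
  exact h.of_homeomorph ⟨⟨fun x => x.1, fun x => ⟨x, x.2⟩, fun _ => rfl, fun _ => rfl⟩,
    continuous_subtype_val, Continuous.subtype_mk continuous_id _⟩

/-- Over a finite union of convex open sets, the Euler characteristic of a finite covering is
defined and multiplicative. -/
theorem IsCoveringMap.exists_hasTopEulerChar_biUnion (cov : IsCoveringMap p) {n : ℕ}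
    (hfin : ∀ b, Finite (p ⁻¹' {b})) (hcard : ∀ b, Nat.card (p ⁻¹' {b}) = n)
    {ι : Type*} (s : Finset ι) (U : ι → Set W) (hU : ∀ i, IsOpen (U i))
    (hconv : ∀ i, Convex ℝ (U i)) (hUB : ∀ i, U i ⊆ B) :
    ∃ χ : ℤ, HasTopEulerChar ↥(⋃ i ∈ s, U i) χ ∧
      HasTopEulerChar ↥{e : E | (p e : W) ∈ ⋃ i ∈ s, U i} (n * χ) := by
  classical
  have hempty : HasTopEulerChar ↥(∅ : Set W) 0 ∧ HasTopEulerChar ↥{e : E | (p e : W) ∈ (∅ : Set W)}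
      (n * 0) := by
    constructor
    · simpa using hasTopEulerChar_of_discrete ↥(∅ : Set W)
    · have : IsEmpty ↥{e : E | (p e : W) ∈ (∅ : Set W)} := ⟨fun e => e.2⟩
      simpa using hasTopEulerChar_of_discrete ↥{e : E | (p e : W) ∈ (∅ : Set W)}
  induction s using Finset.induction_on generalizing U with
  | empty =>
    refine ⟨0, ?_⟩
    have h : ⋃ i ∈ (∅ : Finset ι), U i = ∅ := by simp
    rw [h]
    exact hempty
  | insert a s ha ih =>
    obtain ⟨x, hx, hx'⟩ := ih U hU hconv hUB
    -- The intersection of `U a` with the union over `s` is again a union of convex open sets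
    -- indexed by `s`; this is why the induction generalises over `U`.
    obtain ⟨z, hz, hz'⟩ := ih (fun i => U a ∩ U i) (fun i => (hU a).inter (hU i))
      (fun i => (hconv a).inter (hconv i)) (fun i => Set.inter_subset_left.trans (hUB a))
    rw [← Set.inter_iUnion₂] at hz hz'
    obtain ⟨y, hy, hy'⟩ : ∃ y : ℤ, HasTopEulerChar (U a) y ∧
        HasTopEulerChar ↥{e : E | (p e : W) ∈ U a} (n * y) := by
      rcases (U a).eq_empty_or_nonempty with h | h
      · rw [h]
        exact ⟨0, hempty⟩
      · exact ⟨1, _root_.hasTopEulerChar_convex (hconv a) h, by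
          rw [mul_one]
          exact cov.hasTopEulerChar_convex hfin hcard (hconv a) h (hUB a)⟩
    have hop : IsOpen (⋃ i ∈ s, U i) := isOpen_biUnion fun i _ => hU i
    have hpc : Continuous fun e => (p e : W) := continuous_subtype_val.comp cov.continuous
    rw [Finset.set_biUnion_insert]
    refine ⟨y + x - z, hy.union (hU a) hop hx hz, ?_⟩
    have := hy'.union ((hU a).preimage hpc) (hop.preimage hpc) hx' hz'
    rw [mul_sub, mul_add]
    exact this

theorem exists_hasTopEulerChar_iUnion {ι : Type*} [Finite ι] (U : ι → Set W)
    (hU : ∀ i, IsOpen (U i)) (hconv : ∀ i, Convex ℝ (U i)) :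
    ∃ χ : ℤ, HasTopEulerChar ↥(⋃ i, U i) χ := by
  have := Fintype.ofFinite ι
  obtain ⟨χ, h, -⟩ := (isCoveringMap_refl (Set.univ : Set W)).exists_hasTopEulerChar_biUnion
    (n := 1) (fun b => (inferInstance : Finite ({b} : Set _)))
    (fun b => (Set.ncard_singleton b : Nat.card ({b} : Set _) = 1)) Finset.univ U hU hconv
    (fun i => Set.subset_univ _)
  have h' : ⋃ i ∈ (Finset.univ : Finset ι), U i = ⋃ i, U i := by simp
  rw [h'] at h
  exact ⟨χ, h⟩

/-- The convex cover yields some value satisfying the product formula; uniqueness identifies it with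
the given `χ`. -/
theorem IsCoveringMap.hasTopEulerChar (cov : IsCoveringMap p) {n : ℕ}
    (hfin : ∀ b, Finite (p ⁻¹' {b})) (hcard : ∀ b, Nat.card (p ⁻¹' {b}) = n)
    {ι : Type*} [Finite ι] (U : ι → Set W) (hU : ∀ i, IsOpen (U i))
    (hconv : ∀ i, Convex ℝ (U i)) (hB : B = ⋃ i, U i) {χ : ℤ} (hχ : HasTopEulerChar B χ) :
    HasTopEulerChar E (n * χ) := by
  have := Fintype.ofFinite ι
  obtain ⟨χ', h, h'⟩ := cov.exists_hasTopEulerChar_biUnion hfin hcard Finset.univ U hU hconv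
    (fun i => hB ▸ Set.subset_iUnion U i)
  have hB' : ⋃ i ∈ (Finset.univ : Finset ι), U i = B := by simp [hB]
  rw [hB'] at h h'
  rw [hχ.unique h]
  have huniv : {e : E | (p e : W) ∈ B} = Set.univ := Set.eq_univ_of_forall fun e => (p e).2
  rw [huniv] at h'
  exact h'.of_homeomorph (Homeomorph.Set.univ E)

end Covering

/-! ### Complements of affine arrangements -/

section AffineComplement

variable {W : Type} [AddCommGroup W] [Module ℝ W] [TopologicalSpace W]

/-- A continuous real-affine function with complex values. -/
structure IsContAffine (f : W → ℂ) : Prop where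
  continuous : Continuous f
  affine : ∀ x y (a b : ℝ), a + b = 1 → f (a • x + b • y) = a * f x + b * f y

theorem IsContAffine.isOpen {f : W → ℂ} (hf : IsContAffine f) (c : ℂ) :
    IsOpen {w | 0 < (c * f w).re} :=
  isOpen_lt continuous_const (Complex.continuous_re.comp (continuous_const.mul hf.continuous))

theorem IsContAffine.convex {f : W → ℂ} (hf : IsContAffine f) (c : ℂ) :
    Convex ℝ {w | 0 < (c * f w).re} := by
  intro x hx y hy a b ha hb hab
  have h : (c * f (a • x + b • y)).re = a * (c * f x).re + b * (c * f y).re := by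
    rw [hf.affine x y a b hab, mul_add, mul_left_comm, mul_left_comm c (b : ℂ), Complex.add_re,
      Complex.re_ofReal_mul, Complex.re_ofReal_mul]
  change (0 : ℝ) < (c * f (a • x + b • y)).re
  rw [h]
  rcases ha.eq_or_lt with rfl | ha
  · have : b = 1 := by linarith
    subst this
    simpa using hy
  · exact add_pos_of_pos_of_nonneg (mul_pos ha hx) (mul_nonneg hb (le_of_lt hy))

/-- The four quarter turns have real parts `re z`, `-im z`, `-re z`, `im z`; if none is positive
then `z = 0`. The punctured plane is thus covered by four open half planes. -/
theorem exists_re_pos {z : ℂ} (hz : z ≠ 0) : ∃ k : Fin 4, 0 < (Complex.I ^ (k : ℕ) * z).re := by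
  by_contra! h
  have h0 := h 0
  have h1 := h 1
  have h2 := h 2
  have h3 := h 3
  norm_num [pow_succ] at h0 h1 h2 h3
  exact hz (Complex.ext (le_antisymm h0 h2) (le_antisymm h3 h1))

theorem affineComplement_eq_iUnion {W ι : Type*} (f : ι → W → ℂ) :
    {w | ∀ i, f i w ≠ 0} =
      ⋃ k : ι → Fin 4, ⋂ i, {w | 0 < (Complex.I ^ (k i : ℕ) * f i w).re} := by
  ext w
  simp only [Set.mem_ofPred_eq, Set.mem_iUnion, Set.mem_iInter]
  constructor
  · intro h
    choose k hk using fun i => exists_re_pos (h i)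
    exact ⟨k, hk⟩
  · rintro ⟨k, hk⟩ i hi
    have := hk i
    rw [hi, mul_zero] at this
    exact lt_irrefl _ this

variable [ContinuousAdd W] [ContinuousSMul ℝ W] {ι : Type*} [Finite ι] {f : ι → W → ℂ}

theorem exists_hasTopEulerChar_affineComplement (hf : ∀ i, IsContAffine (f i)) :
    ∃ χ : ℤ, HasTopEulerChar ↥{w | ∀ i, f i w ≠ 0} χ := by
  rw [affineComplement_eq_iUnion]
  exact exists_hasTopEulerChar_iUnion _ (fun _ => isOpen_iInter_of_finite fun i => (hf i).isOpen _)
    (fun _ => convex_iInter fun i => (hf i).convex _)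

theorem hasTopEulerChar_covering_affineComplement (hf : ∀ i, IsContAffine (f i))
    {E : Type} [TopologicalSpace E]
    {p : E → {w | ∀ i, f i w ≠ 0}} (cov : IsCoveringMap p) {n : ℕ}
    (hfin : ∀ b, Finite (p ⁻¹' {b})) (hcard : ∀ b, Nat.card (p ⁻¹' {b}) = n)
    {χ : ℤ} (hχ : HasTopEulerChar ↥{w | ∀ i, f i w ≠ 0} χ) : HasTopEulerChar E (n * χ) :=
  cov.hasTopEulerChar hfin hcard _ (fun _ => isOpen_iInter_of_finite fun i => (hf i).isOpen _)
    (fun _ => convex_iInter fun i => (hf i).convex _) (affineComplement_eq_iUnion f) hχ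

end AffineComplement

/-! ### Tubes and the deletion formula -/

section Tube

open unitInterval

/-- The tube over the common complement of the zeros of `f i`, with radius bounded by
`‖f i‖ / ‖u i‖` for each `i`, restricted to the fiber coordinates in `A`. -/
def tube {W ι : Type*} (f : ι → W → ℂ) (u : ι → ℂ) (A : Set ℂ) : Set (W × ℂ) :=
  {q | (∀ i, ‖u i * q.2‖ < ‖f i q.1‖) ∧ q.2 ∈ A}

theorem tube_inter {W ι : Type*} (f : ι → W → ℂ) (u : ι → ℂ) (A B : Set ℂ) :
    tube f u A ∩ tube f u B = tube f u (A ∩ B) := by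
  ext q
  exact ⟨fun h => ⟨h.1.1, h.1.2, h.2.2⟩, fun h => ⟨⟨h.1, h.2.1⟩, h.1, h.2.2⟩⟩

theorem tube_union {W ι : Type*} (f : ι → W → ℂ) (u : ι → ℂ) (A B : Set ℂ) :
    tube f u A ∪ tube f u B = tube f u (A ∪ B) := by
  ext q
  exact ⟨fun h => h.elim (fun h => ⟨h.1, Or.inl h.2⟩) fun h => ⟨h.1, Or.inr h.2⟩,
    fun h => h.2.imp (fun h' => ⟨h.1, h'⟩) fun h' => ⟨h.1, h'⟩⟩

variable {W : Type} [TopologicalSpace W] {ι : Type*} [Finite ι] {f : ι → W → ℂ}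

theorem isOpen_tube (hf : ∀ i, Continuous (f i)) (u : ι → ℂ) {A : Set ℂ} (hA : IsOpen A) :
    IsOpen (tube f u A) := by
  have h1 : {q : W × ℂ | ∀ i, ‖u i * q.2‖ < ‖f i q.1‖} = ⋂ i, {q | ‖u i * q.2‖ < ‖f i q.1‖} := by
    ext q
    simp
  have h2 : IsOpen {q : W × ℂ | ∀ i, ‖u i * q.2‖ < ‖f i q.1‖} := by
    rw [h1]
    refine isOpen_iInter_of_finite fun i => isOpen_lt ?_ ?_
    · fun_prop
    · have := hf i
      fun_prop
  exact h2.inter (hA.preimage continuous_snd)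

/-- The section `x ↦ (x, ρ x * c)`, with `ρ` small enough to stay in the tube, is a homotopy inverse
of the projection. The condition `hA` lets every point of `A` slide straight to any point of the
open ray through `c`. -/
theorem hasTopEulerChar_tube (hf : ∀ i, Continuous (f i)) (u : ι → ℂ) {A : Set ℂ} {c : ℂ}
    (hc : ‖c‖ = 1) (hA : ∀ y ∈ A, ∀ ε t : ℝ, 0 < ε → 0 ≤ t → t ≤ 1 → (1 - t) * y + t * (ε * c) ∈ A)
    (hcA : ∀ ε : ℝ, 0 < ε → ε * c ∈ A) {χ : ℤ} (hχ : HasTopEulerChar ↥{x | ∀ i, f i x ≠ 0} χ) :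
    HasTopEulerChar ↥(tube f u A) χ := by
  have := Fintype.ofFinite ι
  let Z : Set W := {x | ∀ i, f i x ≠ 0}
  obtain ⟨ρ, hρ, hρf, hρc⟩ : ∃ ρ : W → ℝ, (∀ x, 0 < ρ x) ∧
      (∀ x ∈ Z, ∀ i, ‖u i‖ * ρ x < ‖f i x‖) ∧ Continuous fun x : Z => ρ x := by
    -- A continuous substitute for the minimum of the radii `‖f i x‖ / ‖u i‖`. The summand `1` makes
    -- the bound strict and covers vanishing `u i` and an empty index set.
    refine ⟨fun x => (1 + ∑ i, ‖u i‖ / ‖f i x‖)⁻¹, fun x => by positivity, fun x hx i => ?_, ?_⟩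
    · have hfx : 0 < ‖f i x‖ := norm_pos_iff.2 (hx i)
      have h1 : ‖u i‖ / ‖f i x‖ < 1 + ∑ j, ‖u j‖ / ‖f j x‖ := by
        have := Finset.single_le_sum (f := fun j => ‖u j‖ / ‖f j x‖) (fun j _ => by positivity)
          (Finset.mem_univ i)
        linarith
      rw [← div_eq_mul_inv, div_lt_iff₀ (by positivity)]
      rw [div_lt_iff₀ hfx] at h1
      linarith
    · refine Continuous.inv₀ (continuous_const.add (continuous_finsetSum _ fun i _ => ?_))
        fun x => by positivity
      exact continuous_const.div ((hf i).comp continuous_subtype_val).norm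
        fun x => norm_ne_zero_iff.2 (x.2 i)
  have hZ : ∀ q ∈ tube f u A, q.1 ∈ Z := fun q hq i h0 => by
    have := hq.1 i
    rw [h0, norm_zero] at this
    exact absurd this (norm_nonneg _).not_gt
  let s : C(Z, tube f u A) := ⟨fun x => ⟨(x, ρ x * c), fun i => by
      change ‖u i * (ρ x * c)‖ < ‖f i x‖
      rw [norm_mul, norm_mul, hc, mul_one, Complex.norm_real, Real.norm_of_nonneg (hρ x).le]
      exact hρf x x.2 i, hcA _ (hρ x)⟩, by
    refine Continuous.subtype_mk ?_ _
    exact continuous_subtype_val.prodMk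
      ((Complex.continuous_ofReal.comp hρc).mul continuous_const)⟩
  let r : C(tube f u A, Z) := ⟨fun q => ⟨q.1.1, hZ q.1 q.2⟩, by fun_prop⟩
  refine hχ.of_homotopyInverse s r ?_ ?_
  · exact ContinuousMap.Homotopic.refl _
  · have hmem : ∀ (t : I) (q : tube f u A),
        (q.1.1, (1 - ((t : ℝ) : ℂ)) * q.1.2 + ((t : ℝ) : ℂ) * (ρ q.1.1 * c)) ∈
          tube f u A := by
      rintro t q
      refine ⟨fun i => ?_, hA _ q.2.2 _ _ (hρ _) t.2.1 t.2.2⟩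
      have h1 := q.2.1 i
      have h2 := hρf _ (hZ q.1 q.2) i
      have ht0 : 0 ≤ (t : ℝ) := t.2.1
      have ht1 : (t : ℝ) ≤ 1 := t.2.2
      calc ‖u i * ((1 - ((t : ℝ) : ℂ)) * q.1.2 + ((t : ℝ) : ℂ) * (ρ q.1.1 * c))‖
          = ‖((1 - (t : ℝ) : ℝ) : ℂ) * (u i * q.1.2) + ((t : ℝ) : ℂ) * (u i * (ρ q.1.1 * c))‖ := by
            push_cast
            ring_nf
        _ ≤ (1 - t) * ‖u i * q.1.2‖ + t * (‖u i‖ * ρ q.1.1) := by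
            refine (norm_add_le _ _).trans (le_of_eq ?_)
            rw [norm_mul, norm_mul ((t : ℝ) : ℂ), Complex.norm_real, Complex.norm_real,
              Real.norm_of_nonneg (sub_nonneg.2 ht1), Real.norm_of_nonneg ht0,
              norm_mul (u i) (_ * c), norm_mul _ c, hc, mul_one, Complex.norm_real,
              Real.norm_of_nonneg (hρ _).le]
        _ < ‖f i q.1.1‖ := by
            rcases ht0.eq_or_lt with h | h
            · rw [← h]
              simpa using h1
            · have := mul_lt_mul_of_pos_left h2 h
              have := mul_le_mul_of_nonneg_left h1.le (sub_nonneg.2 ht1)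
              linarith
    refine ContinuousMap.Homotopic.symm ⟨⟨⟨fun x => ⟨_, hmem x.1 x.2⟩, ?_⟩, ?_, ?_⟩⟩
    · refine Continuous.subtype_mk ?_ _
      have : Continuous fun x : I × tube f u A => ρ x.2.1.1 :=
        hρc.comp (r.continuous.comp continuous_snd)
      have h2 : Continuous fun x : I × tube f u A => ((ρ x.2.1.1 : ℝ) : ℂ) :=
        Complex.continuous_ofReal.comp this
      refine Continuous.prodMk (by fun_prop) (Continuous.add (by fun_prop) ?_)
      exact Continuous.mul (by fun_prop) (h2.mul continuous_const)
    · intro q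
      refine Subtype.ext (Prod.ext rfl ?_)
      simp
    · intro q
      refine Subtype.ext (Prod.ext rfl ?_)
      simp [s, r]

/-- The punctured plane is the union of the slit plane and its negative, which meet in the disjoint
upper and lower half planes. Each of these four sets gives a tube with the Euler characteristic of
the base, so the total is `χ + χ - (χ + χ) = 0`. -/
theorem hasTopEulerChar_tube_punctured (hf : ∀ i, Continuous (f i)) (u : ι → ℂ) {χ : ℤ}
    (hχ : HasTopEulerChar ↥{x | ∀ i, f i x ≠ 0} χ) : HasTopEulerChar ↥(tube f u {0}ᶜ) 0 := by
  have hslit : ∀ y ∈ Complex.slitPlane, ∀ ε t : ℝ, 0 < ε → 0 ≤ t → t ≤ 1 →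
      (1 - t) * y + t * (ε * 1) ∈ Complex.slitPlane := by
    intro y hy ε t hε ht0 ht1
    have hre : ((1 - (t : ℂ)) * y + t * (ε * 1)).re = (1 - t) * y.re + t * ε := by simp
    have him : ((1 - (t : ℂ)) * y + t * (ε * 1)).im = (1 - t) * y.im := by simp
    rw [Complex.mem_slitPlane_iff, hre, him]
    rcases ht1.eq_or_lt with rfl | ht1
    · left
      simpa using hε
    · rcases Complex.mem_slitPlane_iff.1 hy with h | h
      · left
        have := mul_pos (sub_pos.2 ht1) h
        have := mul_nonneg ht0 hε.le
        linarith
      · right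
        exact mul_ne_zero (sub_pos.2 ht1).ne' h
  have h1 : HasTopEulerChar ↥(tube f u Complex.slitPlane) χ :=
    hasTopEulerChar_tube hf u (c := 1) (by simp) hslit
      (fun ε hε => by simpa using hε) hχ
  have h2 : HasTopEulerChar ↥(tube f u (-Complex.slitPlane)) χ := by
    refine hasTopEulerChar_tube hf u (c := -1) (by simp) (fun y hy ε t hε ht0 ht1 => ?_)
      (fun ε hε => ?_) hχ
    · rw [Set.mem_neg] at hy ⊢
      convert hslit (-y) hy ε t hε ht0 ht1 using 1
      ring
    · rw [Set.mem_neg]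
      simpa using hε
  have hup : IsOpen {y : ℂ | 0 < y.im} := isOpen_lt continuous_const Complex.continuous_im
  have hdown : IsOpen {y : ℂ | y.im < 0} := isOpen_lt Complex.continuous_im continuous_const
  have h3 : HasTopEulerChar ↥(tube f u {y : ℂ | 0 < y.im}) χ := by
    refine hasTopEulerChar_tube hf u (c := Complex.I) (by simp) (fun y hy ε t hε ht0 ht1 => ?_)
      (fun ε hε => by simpa using hε) hχ
    have him : ((1 - (t : ℂ)) * y + t * (ε * Complex.I)).im = (1 - t) * y.im + t * ε := by simp
    rw [Set.mem_ofPred_eq] at hy ⊢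
    rw [him]
    rcases ht1.eq_or_lt with rfl | ht1
    · simpa using hε
    · have := mul_pos (sub_pos.2 ht1) hy
      have := mul_nonneg ht0 hε.le
      linarith
  have h4 : HasTopEulerChar ↥(tube f u {y : ℂ | y.im < 0}) χ := by
    refine hasTopEulerChar_tube hf u (c := -Complex.I) (by simp) (fun y hy ε t hε ht0 ht1 => ?_)
      (fun ε hε => by simpa using hε) hχ
    have him : ((1 - (t : ℂ)) * y + t * (ε * -Complex.I)).im = (1 - t) * y.im - t * ε := by
      simp
      ring
    rw [Set.mem_ofPred_eq] at hy ⊢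
    rw [him]
    rcases ht1.eq_or_lt with rfl | ht1
    · simpa using hε
    · have := mul_neg_of_pos_of_neg (sub_pos.2 ht1) hy
      have := mul_nonneg ht0 hε.le
      linarith
  have h5 : HasTopEulerChar ↥(tube f u {y : ℂ | 0 < y.im} ∩ tube f u {y : ℂ | y.im < 0}) 0 := by
    have : IsEmpty ↥(tube f u {y : ℂ | 0 < y.im} ∩ tube f u {y : ℂ | y.im < 0}) :=
      ⟨fun q => lt_asymm (a := (0 : ℝ)) (b := q.1.2.im) q.2.1.2 q.2.2.2⟩
    simpa using hasTopEulerChar_of_discrete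
      ↥(tube f u {y : ℂ | 0 < y.im} ∩ tube f u {y : ℂ | y.im < 0})
  have h6 := h3.union (isOpen_tube hf u hup) (isOpen_tube hf u hdown) h4 h5
  have e1 : Complex.slitPlane ∩ -Complex.slitPlane = {y : ℂ | 0 < y.im} ∪ {y : ℂ | y.im < 0} := by
    ext y
    simp only [Set.mem_inter_iff, Complex.mem_slitPlane_iff, Set.mem_neg, Set.mem_union,
      Set.mem_ofPred_eq, Complex.neg_re, Complex.neg_im]
    constructor
    · rintro ⟨h | h, h' | h'⟩
      · linarith
      all_goals first | exact (Ne.lt_or_gt h).symm | exact (Ne.lt_or_gt (neg_ne_zero.1 h')).symm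
    · rintro (h | h)
      · exact ⟨Or.inr h.ne', Or.inr (neg_ne_zero.2 h.ne')⟩
      · exact ⟨Or.inr h.ne, Or.inr (neg_ne_zero.2 h.ne)⟩
  have e2 : Complex.slitPlane ∪ -Complex.slitPlane = {0}ᶜ := by
    ext y
    simp only [Complex.mem_slitPlane_iff, Set.mem_neg, Set.mem_union, Complex.neg_re,
      Complex.neg_im, Set.mem_compl_iff, Set.mem_singleton_iff]
    constructor
    · rintro h rfl
      simp at h
    · intro h
      by_contra! hc
      exact h (Complex.ext (le_antisymm hc.1.1 (neg_nonpos.1 hc.2.1)) hc.1.2)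
  rw [tube_union, ← e1, ← tube_inter] at h6
  have h7 := h1.union (isOpen_tube hf u Complex.isOpen_slitPlane)
    (isOpen_tube hf u Complex.isOpen_slitPlane.neg) h2 h6
  rw [tube_union, e2] at h7
  convert h7 using 1
  ring

/-- Deletion of a hyperplane from an affine arrangement: the Euler characteristic of the
complement. -/
theorem HasTopEulerChar.deletion (hf : ∀ i, Continuous (f i)) (u : ι → ℂ) {x z : ℤ}
    (hx : HasTopEulerChar ↥{q : W × ℂ | (∀ i, f i q.1 + u i * q.2 ≠ 0) ∧ q.2 ≠ 0} x)
    (hz : HasTopEulerChar ↥{x | ∀ i, f i x ≠ 0} z) :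
    HasTopEulerChar ↥{q : W × ℂ | ∀ i, f i q.1 + u i * q.2 ≠ 0} (x + z) := by
  have hN : HasTopEulerChar ↥(tube f u Set.univ) z :=
    hasTopEulerChar_tube hf u (c := 1) (by simp) (by simp) (by simp) hz
  have hN' := hasTopEulerChar_tube_punctured hf u hz
  set M := {q : W × ℂ | (∀ i, f i q.1 + u i * q.2 ≠ 0) ∧ q.2 ≠ 0} with hM
  have hMo : IsOpen M := by
    have h1 : {q : W × ℂ | ∀ i, f i q.1 + u i * q.2 ≠ 0} =
        ⋂ i, {q : W × ℂ | f i q.1 + u i * q.2 ≠ 0} := by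
      ext q
      simp
    have h2 : IsOpen {q : W × ℂ | ∀ i, f i q.1 + u i * q.2 ≠ 0} := by
      rw [h1]
      refine isOpen_iInter_of_finite fun i => isOpen_ne_fun ?_ continuous_const
      have := hf i
      fun_prop
    exact h2.inter (isOpen_ne_fun continuous_snd continuous_const)
  -- In the tube `u i * q.2` is strictly smaller than `f i q.1`, so it cannot cancel it.
  have hne : ∀ q ∈ tube f u Set.univ, ∀ i, f i q.1 + u i * q.2 ≠ 0 := fun q hq i h0 => by
    have := hq.1 i
    rw [eq_neg_of_add_eq_zero_left h0, norm_neg] at this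
    exact lt_irrefl _ this
  have hinter : M ∩ tube f u Set.univ = tube f u {0}ᶜ := by
    ext q
    exact ⟨fun h => ⟨h.2.1, h.1.2⟩, fun h => ⟨⟨hne q ⟨h.1, trivial⟩, h.2⟩, h.1, trivial⟩⟩
  have hunion : M ∪ tube f u Set.univ = {q : W × ℂ | ∀ i, f i q.1 + u i * q.2 ≠ 0} := by
    ext q
    constructor
    · rintro (h | h)
      · exact h.1
      · exact hne q h
    · intro h
      by_cases hq : q.2 = 0
      · refine Or.inr ⟨fun i => ?_, trivial⟩
        have := h i
        rw [hq, mul_zero, add_zero] at this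
        rw [hq, mul_zero, norm_zero]
        exact norm_pos_iff.2 this
      · exact Or.inl ⟨h, hq⟩
  rw [← hinter] at hN'
  have := hx.union hMo (isOpen_tube hf u isOpen_univ) hN hN'
  rwa [hunion, sub_zero] at this

end Tube

/-! ### The complex line minus finitely many points -/

section Points

/-- Deletion over a one-point base, with the coordinate of `ℂ` centred at the new point `a`: the
fiber over `0` is a single point, so each removed point lowers `χ` by `1`. -/
theorem hasTopEulerChar_compl_finset (T : Finset ℂ) :
    HasTopEulerChar ↥{x : ℂ | ∀ t ∈ T, x ≠ t} (1 - T.card) := by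
  induction T using Finset.induction_on with
  | empty =>
    have h : {x : ℂ | ∀ t ∈ (∅ : Finset ℂ), x ≠ t} = Set.univ := by simp
    rw [h]
    simpa using hasTopEulerChar_convex (W := ℂ) convex_univ Set.univ_nonempty
  | insert a T ha ih =>
    let f : T → PUnit.{1} → ℂ := fun t _ => a - t
    have hfc : ∀ t, Continuous (f t) := fun t => continuous_const
    let F : Option T → PUnit.{1} × ℂ → ℂ := fun o q => o.elim q.2 fun t => q.2 + (a - t)
    have hF : ∀ o, IsContAffine (F o) := by
      rintro (_ | t)
      · exact ⟨continuous_snd, fun x y a b _ => by simp [F]⟩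
      · refine ⟨continuous_snd.add continuous_const, fun x y r s hrs => ?_⟩
        have hs : s = 1 - r := by linarith
        have : (s : ℂ) = 1 - r := by rw [hs]; push_cast; ring
        simp only [F, Option.elim_some, Prod.snd_add, Prod.smul_snd, Complex.real_smul, this]
        ring
    -- Deletion computes the larger complement from the smaller one. Existence for the smaller one
    -- comes from the convex cover, and its value is then solved for by uniqueness.
    obtain ⟨x, hx⟩ := exists_hasTopEulerChar_affineComplement hF
    have e1 : {w | ∀ o, F o w ≠ 0} =
        {q : PUnit.{1} × ℂ | (∀ t, f t q.1 + 1 * q.2 ≠ 0) ∧ q.2 ≠ 0} := by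
      ext q
      simp only [Set.mem_ofPred_eq, Option.forall, F, f, one_mul, Option.elim_some,
        Option.elim_none, add_comm]
      exact and_comm
    have hz : HasTopEulerChar ↥{x | ∀ t, f t x ≠ 0} 1 := by
      have : {x | ∀ t, f t x ≠ 0} = Set.univ := Set.eq_univ_of_forall fun _ t => by
        refine sub_ne_zero.2 ?_
        rintro rfl
        exact ha t.2
      rw [this]
      simpa using hasTopEulerChar_of_discrete ↥(Set.univ : Set PUnit.{1})
    have hdel := HasTopEulerChar.deletion hfc (fun _ => 1) (e1 ▸ hx) hz
    let e : PUnit.{1} × ℂ ≃ₜ ℂ := (Homeomorph.punitProd ℂ).trans (Homeomorph.addRight a)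
    have he : ∀ q, e q = q.2 + a := fun q => rfl
    have h1 := hdel.of_homeomorph (Y := {x : ℂ | ∀ t ∈ T, x ≠ t}) (e.subtype fun q => by
      simp only [f, one_mul, Set.mem_ofPred_eq, Subtype.forall, he]
      refine forall₂_congr fun t _ => not_congr ?_
      rw [← sub_eq_zero (b := t)]
      ring_nf)
    have h2 := hx.of_homeomorph (Y := {x : ℂ | ∀ t ∈ insert a T, x ≠ t}) (e.subtype fun q => by
      simp only [F, Option.forall, Option.elim_some, Option.elim_none, Set.mem_ofPred_eq,
        Subtype.forall, he,
        Finset.forall_mem_insert]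
      refine and_congr (not_congr ?_) (forall₂_congr fun t _ => not_congr ?_)
      · simp
      · rw [← sub_eq_zero (b := t)]
        ring_nf)
    have := ih.unique h1
    rw [Finset.card_insert_of_notMem ha]
    convert h2 using 1
    push_cast
    linarith

end Points

/-! ### Linear coordinates adapted to two forms -/

section Coordinates

/-- Two nonzero linear forms on `ℂ³` with distinct kernels have a dual pair of vectors. -/
theorem exists_apply_eq_one_of_ker_ne {ℓ h : Module.Dual ℂ C3} (hℓ : ℓ ≠ 0) (hh : h ≠ 0)
    (hne : LinearMap.ker ℓ ≠ LinearMap.ker h) : ∃ v, ℓ v = 1 ∧ h v = 0 := by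
  by_contra! hcon
  refine hne (Submodule.eq_of_le_of_finrank_eq ?_ ?_).symm
  · intro v hv
    by_contra hℓv
    refine hcon ((ℓ v)⁻¹ • v) ?_ ?_
    · rw [map_smul, smul_eq_mul, inv_mul_cancel₀ hℓv]
    · rw [map_smul, LinearMap.mem_ker.1 hv, smul_zero]
  · have h1 := Module.Dual.finrank_ker_add_one_of_ne_zero hℓ
    have h2 := Module.Dual.finrank_ker_add_one_of_ne_zero hh
    omega

theorem finrank_ker_inf_ker {ℓ h : Module.Dual ℂ C3} (hℓ : ℓ ≠ 0) (hh : h ≠ 0)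
    (hne : LinearMap.ker ℓ ≠ LinearMap.ker h) :
    Module.finrank ℂ ↥(LinearMap.ker ℓ ⊓ LinearMap.ker h) = 1 := by
  obtain ⟨v, hv1, hv0⟩ := exists_apply_eq_one_of_ker_ne hℓ hh hne
  obtain ⟨w, hw1, hw0⟩ := exists_apply_eq_one_of_ker_ne hh hℓ hne.symm
  have hsurj : LinearMap.range (ℓ.prod h) = ⊤ := by
    refine LinearMap.range_eq_top.2 fun x => ⟨x.1 • v + x.2 • w, ?_⟩
    ext <;> simp [hv1, hv0, hw1, hw0]
  have := LinearMap.finrank_range_add_finrank_ker (ℓ.prod h)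
  rw [hsurj, LinearMap.ker_prod] at this
  simp at this
  omega

/-- Coordinates on the affine plane `ℓ = 1` in which `h` is the second coordinate. -/
theorem exists_affine_coordinates {ℓ h : Module.Dual ℂ C3} (hℓ : ℓ ≠ 0) (hh : h ≠ 0)
    (hne : LinearMap.ker ℓ ≠ LinearMap.ker h) :
    ∃ (e₀ e₁ e₂ : C3) (Ψ : ℂ × ℂ ≃ₜ {v : C3 // ℓ v = 1}),
      (ℓ e₀ = 1 ∧ h e₀ = 0) ∧ (ℓ e₁ = 0 ∧ h e₁ = 1) ∧ (ℓ e₂ = 0 ∧ h e₂ = 0) ∧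
      (∀ v, ∃ x : ℂ, v = ℓ v • e₀ + h v • e₁ + x • e₂) ∧ e₂ ≠ 0 ∧
      ∀ q, (Ψ q).1 = e₀ + q.2 • e₁ + q.1 • e₂ := by
  obtain ⟨e₀, h00, h01⟩ := exists_apply_eq_one_of_ker_ne hℓ hh hne
  obtain ⟨e₁, h11, h10⟩ := exists_apply_eq_one_of_ker_ne hh hℓ hne.symm
  obtain ⟨e₂, hmem, he₂⟩ : ∃ v ∈ LinearMap.ker ℓ ⊓ LinearMap.ker h, v ≠ 0 := by
    refine Submodule.exists_mem_ne_zero_of_ne_bot fun hbot => ?_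
    have := finrank_ker_inf_ker hℓ hh hne
    rw [hbot, finrank_bot] at this
    exact zero_ne_one this
  obtain ⟨h20, h21⟩ := hmem
  rw [SetLike.mem_coe, LinearMap.mem_ker] at h20 h21
  let φ : ℂ × ℂ × ℂ →ₗ[ℂ] C3 :=
    (LinearMap.toSpanSingleton ℂ C3 e₀).coprod
      ((LinearMap.toSpanSingleton ℂ C3 e₁).coprod (LinearMap.toSpanSingleton ℂ C3 e₂))
  have hφ : ∀ t y x, φ (t, y, x) = t • e₀ + y • e₁ + x • e₂ := fun t y x => by
    simp [φ, add_assoc]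
  have hℓφ : ∀ q, ℓ (φ q) = q.1 := fun ⟨t, y, x⟩ => by simp [hφ, h00, h10, h20]
  have hhφ : ∀ q, h (φ q) = q.2.1 := fun ⟨t, y, x⟩ => by simp [hφ, h01, h11, h21]
  have hinj : Function.Injective φ := by
    refine (injective_iff_map_eq_zero φ).2 fun ⟨t, y, x⟩ hq => ?_
    have ht : t = 0 := by have := hℓφ (t, y, x); rwa [hq, map_zero, eq_comm] at this
    have hy : y = 0 := by have := hhφ (t, y, x); rwa [hq, map_zero, eq_comm] at this
    rw [hφ, ht, hy, zero_smul, zero_smul, zero_add, zero_add, smul_eq_zero] at hq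
    rw [ht, hy, hq.resolve_right he₂]
    rfl
  -- In the coordinates `(t, y, x)` of `Φ`, `ℓ` is `t` and `h` is `y`; the chart is the slice `t =
  -- 1`, with `x` and `y` swapped so that `h` comes second.
  let Φ := (LinearEquiv.ofInjectiveOfFinrankEq φ hinj (by simp)).toContinuousLinearEquiv
  have hΦ : ∀ q, Φ q = φ q := fun q => rfl
  have hΦℓ : ∀ v, (Φ.symm v).1 = ℓ v := fun v => by
    rw [← hℓφ, ← hΦ, Φ.apply_symm_apply]
  have hΦh : ∀ v, (Φ.symm v).2.1 = h v := fun v => by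
    rw [← hhφ, ← hΦ, Φ.apply_symm_apply]
  refine ⟨e₀, e₁, e₂,
    { toFun := fun q => ⟨Φ (1, q.2, q.1), by rw [hΦ, hℓφ]⟩
      invFun := fun v => ((Φ.symm v).2.2, (Φ.symm v).2.1)
      left_inv := fun q => by simp
      right_inv := fun v => by
        refine Subtype.ext (Φ.symm.injective ?_)
        rw [Φ.symm_apply_apply]
        refine Prod.ext ?_ rfl
        rw [hΦℓ, v.2]
      continuous_toFun := by
        refine Continuous.subtype_mk (Φ.continuous.comp ?_) _
        fun_prop
      continuous_invFun := by
        have := Φ.symm.continuous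
        fun_prop },
    ⟨h00, h01⟩, ⟨h10, h11⟩, ⟨h20, h21⟩, fun v => ⟨(Φ.symm v).2.2, ?_⟩, he₂, fun q => ?_⟩
  · rw [← hΦℓ, ← hΦh, ← hφ, ← hΦ]
    exact (Φ.apply_symm_apply v).symm
  · change φ (1, q.2, q.1) = _
    rw [hφ, one_smul]

end Coordinates

/-! ### Projective complements and their affine charts -/

section ProjComp

/-- The complement in the projective plane of the zero loci of a set of linear forms. -/
def projComp (G : Set (Module.Dual ℂ C3)) : Set CP2 := {p | ∀ g ∈ G, g p.rep ≠ 0}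

theorem apply_rep_ne_zero_iff (g : Module.Dual ℂ C3) {v : C3} (hv : v ≠ 0) :
    g (Projectivization.mk ℂ v hv).rep ≠ 0 ↔ g v ≠ 0 := by
  obtain ⟨a, ha⟩ := Projectivization.exists_smul_eq_mk_rep ℂ v hv
  rw [← ha, Units.smul_def, map_smul, smul_eq_mul]
  simp

theorem mk_mem_projComp {G : Set (Module.Dual ℂ C3)} {v : C3} (hv : v ≠ 0) :
    Projectivization.mk ℂ v hv ∈ projComp G ↔ ∀ g ∈ G, g v ≠ 0 :=
  forall₂_congr fun g _ => apply_rep_ne_zero_iff g hv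

theorem projComp_union (G G' : Set (Module.Dual ℂ C3)) :
    projComp (G ∪ G') = projComp G ∩ projComp G' := by
  ext p
  simp only [projComp, Set.mem_union, Set.mem_ofPred_eq, Set.mem_inter_iff, or_imp,
    forall_and]

theorem projComp_empty : projComp ∅ = Set.univ :=
  Set.eq_univ_of_forall fun _ _ h => h.elim

theorem isQuotientMap_mk :
    Topology.IsQuotientMap fun v : {v : C3 // v ≠ 0} => Projectivization.mk ℂ v.1 v.2 :=
  isQuotientMap_quotient_mk'

theorem isOpen_projComp {G : Set (Module.Dual ℂ C3)} (hG : G.Finite) : IsOpen (projComp G) := by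
  rw [← isQuotientMap_mk.isOpen_preimage]
  have : (fun v : {v : C3 // v ≠ 0} => Projectivization.mk ℂ v.1 v.2) ⁻¹' projComp G =
      ⋂ g ∈ G, {v | g v.1 ≠ 0} := by
    ext v
    simp only [Set.mem_preimage, mk_mem_projComp, Set.mem_iInter, Set.mem_ofPred_eq]
  rw [this]
  refine hG.isOpen_biInter fun g _ => ?_
  exact isOpen_ne.preimage ((g.continuous_of_finiteDimensional).comp continuous_subtype_val)

/-- The affine chart of `projComp G` in which the form `ℓ ∈ G` is normalised to `1`. -/
def projCompChart {G : Set (Module.Dual ℂ C3)} (hG : G.Finite) {ℓ : Module.Dual ℂ C3}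
    (hℓ : ℓ ∈ G) :
    {v : {v : C3 // ℓ v = 1} // ∀ g ∈ G, g v.1 ≠ 0} ≃ₜ ↥(projComp G) where
  toFun v := ⟨Projectivization.mk ℂ v.1.1 (fun h => by simpa [h] using v.1.2),
    (mk_mem_projComp _).2 v.2⟩
  invFun p := ⟨⟨(ℓ p.1.rep)⁻¹ • p.1.rep, by
      rw [map_smul, smul_eq_mul, inv_mul_cancel₀ (p.2 ℓ hℓ)]⟩, fun g hg => by
      rw [map_smul, smul_eq_mul]
      exact mul_ne_zero (inv_ne_zero (p.2 ℓ hℓ)) (p.2 g hg)⟩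
  left_inv v := by
    refine Subtype.ext (Subtype.ext ?_)
    obtain ⟨a, ha⟩ := Projectivization.exists_smul_eq_mk_rep ℂ v.1.1
      (fun h => by simpa [h] using v.1.2)
    change (ℓ (Projectivization.mk ℂ v.1.1 _).rep)⁻¹ • (Projectivization.mk ℂ v.1.1 _).rep = v.1.1
    rw [← ha, Units.smul_def, map_smul, v.1.2, smul_smul]
    simp
  right_inv p := by
    refine Subtype.ext ?_
    conv_rhs => rw [← p.1.mk_rep]
    exact (Projectivization.mk_eq_mk_iff' ℂ _ _ _ _).2 ⟨_, rfl⟩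
  continuous_toFun := by
    refine Continuous.subtype_mk (isQuotientMap_mk.continuous.comp
      (f := fun v : {v : {v : C3 // ℓ v = 1} // ∀ g ∈ G, g v.1 ≠ 0} =>
        (⟨v.1.1, fun h => by simpa [h] using v.1.2⟩ : {v : C3 // v ≠ 0})) ?_) _
    fun_prop
  continuous_invFun := by
    -- The inverse uses an arbitrary representative, so continuity is checked on vectors. There it
    -- is `v ↦ v / ℓ v`, which does not see the scalar by which the representative differs.
    have hq := isQuotientMap_mk.restrictPreimage_isOpen (isOpen_projComp hG)
    rw [hq.continuous_iff]
    refine Continuous.subtype_mk (Continuous.subtype_mk ?_ _) _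
    have hmem : ∀ v : ↥((fun v : {v : C3 // v ≠ 0} => Projectivization.mk ℂ v.1 v.2) ⁻¹'
        projComp G), ℓ v.1.1 ≠ 0 := fun v => (mk_mem_projComp v.1.2).1 v.2 ℓ hℓ
    have hc : Continuous fun v : ↥((fun v : {v : C3 // v ≠ 0} =>
        Projectivization.mk ℂ v.1 v.2) ⁻¹' projComp G) => (ℓ v.1.1)⁻¹ • v.1.1 := by
      have := ℓ.continuous_of_finiteDimensional
      exact ((this.comp (by fun_prop)).inv₀ hmem).smul (by fun_prop)
    refine hc.congr fun v => ?_
    obtain ⟨a, ha⟩ := Projectivization.exists_smul_eq_mk_rep ℂ v.1.1 v.1.2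
    change _ = (ℓ (Projectivization.mk ℂ v.1.1 v.1.2).rep)⁻¹ •
      (Projectivization.mk ℂ v.1.1 v.1.2).rep
    rw [← ha, Units.smul_def, map_smul, smul_smul, smul_eq_mul, mul_inv, mul_right_comm,
      inv_mul_cancel₀ a.ne_zero, one_mul]

theorem isContAffine_coord (a b c : ℂ) :
    IsContAffine fun q : ℂ × ℂ => a + q.1 * b + c * q.2 := by
  refine ⟨by fun_prop, fun x y r s hrs => ?_⟩
  have hs : s = 1 - r := by linarith
  have : (s : ℂ) = 1 - r := by rw [hs]; push_cast; ring
  simp only [Prod.fst_add, Prod.snd_add, Prod.smul_fst, Prod.smul_snd, Complex.real_smul, this]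
  ring

/-- The chart identifies this complement with the affine plane `ℓ = 1`, which is convex and
nonempty. -/
theorem hasTopEulerChar_projComp_singleton {ℓ : Module.Dual ℂ C3} (hℓ : ℓ ≠ 0) :
    HasTopEulerChar ↥(projComp {ℓ}) 1 := by
  have hconv : Convex ℝ {v : C3 | ℓ v = 1} := by
    intro x hx y hy a b _ _ hab
    have hx : ℓ x = 1 := hx
    have hy : ℓ y = 1 := hy
    change ℓ (a • x + b • y) = 1
    rw [map_add, LinearMap.map_smul_of_tower, LinearMap.map_smul_of_tower, hx, hy, ← add_smul,
      hab, one_smul]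
  have hne : {v : C3 | ℓ v = 1}.Nonempty := by
    obtain ⟨v, hv⟩ := DFunLike.ne_iff.1 hℓ
    exact ⟨(ℓ v)⁻¹ • v, by
      change ℓ ((ℓ v)⁻¹ • v) = 1
      rw [map_smul, smul_eq_mul, inv_mul_cancel₀ hv]⟩
  refine (hasTopEulerChar_convex hconv hne).of_homeomorph (Homeomorph.trans ?_
    (projCompChart (Set.finite_singleton ℓ) rfl))
  refine (Homeomorph.Set.univ _).symm.trans (Homeomorph.setCongr ?_)
  refine (Set.eq_univ_of_forall fun v g hg => ?_).symm
  rw [Set.mem_singleton_iff.1 hg, v.2]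
  exact one_ne_zero

end ProjComp

/-! ### Adding one line to a projective arrangement -/

section Deletion

/-- On the projective line `h = 0`, the points `[e₀ + t e₂]` form an affine chart with `[e₂]` at
infinity. A form with `g e₂ ≠ 0` meets it at `t = -g e₀ / g e₂`, the others at infinity. The `+ 1`
is the point at infinity, always attained because `ℓ ∈ G` vanishes there. -/
theorem ncard_image_ker_inf {G : Set (Module.Dual ℂ C3)} {ℓ h : Module.Dual ℂ C3}
    (hℓ : ℓ ∈ G) {e₀ e₁ e₂ : C3} (h0 : ℓ e₀ = 1 ∧ h e₀ = 0) (h2 : ℓ e₂ = 0 ∧ h e₂ = 0)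
    (hspan : ∀ v, ∃ x : ℂ, v = ℓ v • e₀ + h v • e₁ + x • e₂) (he₂ : e₂ ≠ 0)
    (hG0 : ∀ g ∈ G, g e₂ = 0 → g e₀ ≠ 0) {T : Finset ℂ}
    (hT : (T : Set ℂ) = (fun g : Module.Dual ℂ C3 => -g e₀ / g e₂) '' {g ∈ G | g e₂ ≠ 0}) :
    ((fun g => LinearMap.ker h ⊓ LinearMap.ker g) '' G).ncard = T.card + 1 := by
  have hker : ∀ v, h v = 0 → ∃ x : ℂ, v = ℓ v • e₀ + x • e₂ := fun v hv => by
    obtain ⟨x, hx⟩ := hspan v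
    rw [hv, zero_smul, add_zero] at hx
    exact ⟨x, hx⟩
  let Λ : ℂ → Submodule ℂ C3 := fun t => Submodule.span ℂ {e₀ + t • e₂}
  have hfin : ∀ g ∈ G, g e₂ ≠ 0 →
      LinearMap.ker h ⊓ LinearMap.ker g = Λ (-g e₀ / g e₂) := by
    intro g _ hg
    ext v
    rw [Submodule.mem_inf, LinearMap.mem_ker, LinearMap.mem_ker, Submodule.mem_span_singleton]
    constructor
    · rintro ⟨hv, hgv⟩
      obtain ⟨x, hx⟩ := hker v hv
      refine ⟨ℓ v, ?_⟩
      conv_rhs => rw [hx]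
      rw [hx, map_add, map_smul, map_smul, smul_eq_mul, smul_eq_mul] at hgv
      rw [smul_add, smul_smul]
      congr 2
      field_simp
      linear_combination -hgv
    · rintro ⟨a, rfl⟩
      constructor
      · simp [h0.2, h2.2]
      · simp only [map_smul, map_add, smul_eq_mul]
        field_simp
        ring
  have hinf : ∀ g ∈ G, g e₂ = 0 →
      LinearMap.ker h ⊓ LinearMap.ker g = LinearMap.ker h ⊓ LinearMap.ker ℓ := by
    intro g hgG hg
    ext v
    simp only [Submodule.mem_inf, LinearMap.mem_ker]
    refine and_congr_right fun hv => ?_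
    obtain ⟨x, hx⟩ := hker v hv
    have : g v = ℓ v * g e₀ := by
      conv_lhs => rw [hx]
      simp [hg]
    rw [this, mul_eq_zero, or_iff_left (hG0 g hgG hg)]
  have himg : (fun g => LinearMap.ker h ⊓ LinearMap.ker g) '' G =
      insert (LinearMap.ker h ⊓ LinearMap.ker ℓ) (Λ '' (T : Set ℂ)) := by
    ext L
    simp only [hT, Set.mem_insert_iff, Set.mem_image]
    constructor
    · rintro ⟨g, hg, rfl⟩
      by_cases hg2 : g e₂ = 0
      · exact Or.inl (hinf g hg hg2)
      · exact Or.inr ⟨_, ⟨g, ⟨hg, hg2⟩, rfl⟩, (hfin g hg hg2).symm⟩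
    · rintro (rfl | ⟨_, ⟨g, ⟨hg, hg2⟩, rfl⟩, rfl⟩)
      · exact ⟨ℓ, hℓ, rfl⟩
      · exact ⟨g, hg, hfin g hg hg2⟩
  have hmem : ∀ t, e₀ + t • e₂ ∈ Λ t := fun t => Submodule.mem_span_singleton_self _
  have hℓe : ∀ t : ℂ, ℓ (e₀ + t • e₂) = 1 := fun t => by simp [h0.1, h2.1]
  rw [himg, Set.ncard_insert_of_notMem, Set.ncard_image_of_injective, Set.ncard_coe_finset]
  · intro s t hst
    have := hmem s
    rw [show Λ s = Λ t from hst] at this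
    obtain ⟨c, hc⟩ := Submodule.mem_span_singleton.1 this
    have hc1 : c = 1 := by
      have := congrArg ℓ hc
      rwa [map_smul, hℓe, hℓe, smul_eq_mul, mul_one] at this
    rw [hc1, one_smul, add_right_inj] at hc
    exact (smul_left_injective ℂ he₂ hc).symm
  · rintro ⟨t, -, ht⟩
    have := hmem t
    rw [ht] at this
    have h' : ℓ (e₀ + t • e₂) = 0 := this.2
    exact one_ne_zero ((hℓe t).symm.trans h')

/-- Deleting the line `h = 0` from the complement of a nonempty projective line arrangement. -/
theorem HasTopEulerChar.projComp_insert {G : Set (Module.Dual ℂ C3)} (hG : G.Finite)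
    (hne : G.Nonempty) {h : Module.Dual ℂ C3} (hh : h ≠ 0)
    (hker : ∀ g ∈ G, g ≠ 0 ∧ LinearMap.ker g ≠ LinearMap.ker h) {χ : ℤ}
    (hχ : HasTopEulerChar ↥(projComp G) χ) :
    HasTopEulerChar ↥(projComp (insert h G))
      (χ - (2 - ((fun g => LinearMap.ker h ⊓ LinearMap.ker g) '' G).ncard)) := by
  obtain ⟨ℓ, hℓ⟩ := hne
  obtain ⟨e₀, e₁, e₂, Ψ, h0, h1, h2, hspan, he₂, hΨ⟩ :=
    exists_affine_coordinates (hker ℓ hℓ).1 hh (hker ℓ hℓ).2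
  have hgΨ : ∀ (g : Module.Dual ℂ C3) q, g (Ψ q).1 = g e₀ + q.1 * g e₂ + g e₁ * q.2 :=
    fun g q => by rw [hΨ]; simp; ring
  have hhΨ : ∀ q, h (Ψ q).1 = q.2 := fun q => by rw [hgΨ, h0.2, h1.2, h2.2]; ring
  have hfinG : Finite G := hG
  let f : G → ℂ → ℂ := fun g x => g.1 e₀ + x * g.1 e₂
  let u : G → ℂ := fun g => g.1 e₁
  have hfc : ∀ g, Continuous (f g) := fun g => by fun_prop
  have eG : ↥{q : ℂ × ℂ | ∀ g, f g q.1 + u g * q.2 ≠ 0} ≃ₜ ↥(projComp G) := by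
    refine Homeomorph.trans (Ψ.subtype fun q => ?_) (projCompChart hG hℓ)
    simp only [hgΨ, Set.mem_ofPred_eq, f, u, Subtype.forall]
  have eH : ↥{q : ℂ × ℂ | (∀ g, f g q.1 + u g * q.2 ≠ 0) ∧ q.2 ≠ 0} ≃ₜ
      ↥(projComp (insert h G)) := by
    refine Homeomorph.trans (Ψ.subtype fun q => ?_)
      (projCompChart (hG.insert h) (Set.mem_insert_of_mem h hℓ))
    rw [Set.forall_mem_insert, hhΨ]
    simp only [hgΨ, Set.mem_ofPred_eq, f, u, Subtype.forall]
    exact and_comm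
  -- The convex cover gives existence for the new complement; deletion and uniqueness below fix its
  -- value.
  obtain ⟨x, hx⟩ : ∃ x, HasTopEulerChar
      ↥{q : ℂ × ℂ | (∀ g, f g q.1 + u g * q.2 ≠ 0) ∧ q.2 ≠ 0} x := by
    let F : Option G → ℂ × ℂ → ℂ :=
      fun o q => o.elim (0 + q.1 * 0 + 1 * q.2) fun g => g.1 e₀ + q.1 * g.1 e₂ + g.1 e₁ * q.2
    obtain ⟨x, hx⟩ := exists_hasTopEulerChar_affineComplement (f := F) (by
      rintro (_ | g) <;> exact isContAffine_coord _ _ _)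
    refine ⟨x, hx.of_homeomorph (Homeomorph.setCongr ?_)⟩
    ext q
    simp only [Set.mem_ofPred_eq, Option.forall, F, f, u, Option.elim_none, Option.elim_some,
      mul_zero, zero_add, one_mul]
    exact and_comm
  -- A form vanishing on `e₀` and `e₂` vanishes on the kernel of `h`, so the two kernels would
  -- coincide.
  have hG0 : ∀ g ∈ G, g e₂ = 0 → g e₀ ≠ 0 := by
    intro g hg hg2 hg0
    refine (hker g hg).2 (Submodule.eq_of_le_of_finrank_eq (fun v hv => ?_) ?_).symm
    · obtain ⟨x, hx⟩ := hspan v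
      rw [LinearMap.mem_ker.1 hv, zero_smul, add_zero] at hx
      rw [LinearMap.mem_ker, hx]
      simp [hg0, hg2]
    · have hf1 := Module.Dual.finrank_ker_add_one_of_ne_zero (hker g hg).1
      have hf2 := Module.Dual.finrank_ker_add_one_of_ne_zero hh
      omega
  have hTfin : ((fun g : Module.Dual ℂ C3 => -g e₀ / g e₂) '' {g ∈ G | g e₂ ≠ 0}).Finite :=
    (hG.subset (Set.sep_subset _ _)).image _
  -- The affine part of the line `h = 0` minus its finite intersection points. Counting the point at
  -- infinity as well, `1 - #T` equals `2` minus the number of intersection points.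
  have hz : HasTopEulerChar ↥{x | ∀ g, f g x ≠ 0} (1 - hTfin.toFinset.card) := by
    refine (hasTopEulerChar_compl_finset hTfin.toFinset).of_homeomorph (Homeomorph.setCongr ?_)
    ext x
    simp only [Set.Finite.mem_toFinset, Set.forall_mem_image, Set.mem_ofPred_eq, Subtype.forall,
      and_imp, f]
    refine forall₂_congr fun g hg => ?_
    by_cases hg2 : g e₂ = 0
    · simpa [hg2] using hG0 g hg hg2
    · simp only [hg2, ne_eq, not_false_eq_true, forall_true_left, eq_div_iff hg2]
      refine not_congr ?_
      rw [eq_neg_iff_add_eq_zero, add_comm]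
  have hdel := (hx.deletion hfc u hz).of_homeomorph eG
  rw [ncard_image_ker_inf hℓ h0 h2 hspan he₂ hG0 hTfin.coe_toFinset, hχ.unique hdel]
  convert hx.of_homeomorph eH using 1
  push_cast
  ring

end Deletion

/-! ### The projective plane itself -/

section Plane

theorem hasTopEulerChar_projComp_pair {g h : Module.Dual ℂ C3} (hg : g ≠ 0) (hh : h ≠ 0)
    (hne : LinearMap.ker g ≠ LinearMap.ker h) : HasTopEulerChar ↥(projComp {h, g}) 0 := by
  have := (hasTopEulerChar_projComp_singleton hg).projComp_insert (Set.finite_singleton g)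
    (Set.singleton_nonempty g) hh (fun k hk => by
      rw [Set.mem_singleton_iff.1 hk]
      exact ⟨hg, hne⟩)
  simpa using this

/-- Inclusion–exclusion over the three coordinate charts: each has `χ = 1`, while the double and
triple intersections have `χ = 0`. Deletion cannot reach this case, since it needs a line to place
at infinity. -/
theorem hasTopEulerChar_projectivePlane : HasTopEulerChar ↥(projComp ∅) 3 := by
  let z : Fin 3 → Module.Dual ℂ C3 := fun i => LinearMap.proj i
  have hz : ∀ i, z i ≠ 0 := fun i h => by
    have := LinearMap.congr_fun h (Pi.single i 1)
    simp [z] at this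
  have hzz : ∀ i j, i ≠ j → LinearMap.ker (z i) ≠ LinearMap.ker (z j) := fun i j hij h => by
    have : Pi.single j 1 ∈ LinearMap.ker (z i) := by
      rw [LinearMap.mem_ker]
      exact Pi.single_eq_of_ne hij 1
    rw [h, LinearMap.mem_ker] at this
    simp [z] at this
  have h1 : ∀ i, HasTopEulerChar ↥(projComp {z i}) 1 := fun i =>
    hasTopEulerChar_projComp_singleton (hz i)
  have h2 : ∀ i j, i ≠ j → HasTopEulerChar ↥(projComp {z i, z j}) 0 := fun i j hij =>
    hasTopEulerChar_projComp_pair (hz j) (hz i) (hzz j i hij.symm)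
  have h3 : HasTopEulerChar ↥(projComp {z 2, z 0, z 1}) 0 := by
    have hcard : ((fun g => LinearMap.ker (z 2) ⊓ LinearMap.ker g) '' {z 0, z 1}).ncard = 2 := by
      rw [Set.image_pair, Set.ncard_pair]
      intro h
      have hm : (Pi.single 1 1 : C3) ∈ LinearMap.ker (z 2) ⊓ LinearMap.ker (z 0) := by
        simp [z]
      rw [h] at hm
      simp [z] at hm
    have := (h2 0 1 (by decide)).projComp_insert (Set.toFinite _) ⟨z 0, by simp⟩ (hz 2)
      (fun k hk => by
        rcases hk with rfl | hk
        · exact ⟨hz 0, hzz 0 2 (by decide)⟩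
        · rw [Set.mem_singleton_iff.1 hk]
          exact ⟨hz 1, hzz 1 2 (by decide)⟩)
    rw [hcard] at this
    simpa using this
  have hopen : ∀ i, IsOpen (projComp {z i}) := fun i => isOpen_projComp (Set.finite_singleton _)
  have hopen2 : ∀ i j, IsOpen (projComp {z i, z j}) := fun i j =>
    isOpen_projComp (Set.toFinite _)
  have e01 : projComp {z 0} ∩ projComp {z 1} = projComp {z 0, z 1} := by
    rw [← projComp_union, Set.singleton_union]
  have eint : (projComp {z 0} ∪ projComp {z 1}) ∩ projComp {z 2} =
      projComp {z 2, z 0} ∪ projComp {z 2, z 1} := by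
    rw [Set.union_inter_distrib_right, ← projComp_union, ← projComp_union, Set.union_singleton,
      Set.union_singleton]
  have e012 : projComp {z 2, z 0} ∩ projComp {z 2, z 1} = projComp {z 2, z 0, z 1} := by
    rw [← projComp_union]
    congr 1
    ext x
    simp only [Set.mem_union, Set.mem_insert_iff, Set.mem_singleton_iff]
    tauto
  have hA := (h1 0).union (hopen 0) (hopen 1) (h1 1) (e01 ▸ h2 0 1 (by decide))
  have hB := (h2 2 0 (by decide)).union (hopen2 2 0) (hopen2 2 1) (h2 2 1 (by decide))
    (e012 ▸ h3)
  rw [← eint] at hB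
  have hC := hA.union ((hopen 0).union (hopen 1)) (hopen 2) (h1 2) hB
  have hcover : (projComp {z 0} ∪ projComp {z 1}) ∪ projComp {z 2} = projComp ∅ := by
    rw [projComp_empty, Set.eq_univ_iff_forall]
    intro p
    by_contra hp
    simp only [projComp, Set.mem_union, Set.mem_ofPred_eq, Set.mem_singleton_iff, forall_eq,
      not_or, not_not] at hp
    refine p.rep_nonzero (funext fun i => ?_)
    fin_cases i
    · exact hp.1.1
    · exact hp.1.2
    · exact hp.2
  rw [hcover] at hC
  simpa using hC

end Plane

/-! ### Counting flats and the Euler characteristic of the complement -/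

namespace CentralArrangement

variable {d : ℕ} (A : CentralArrangement d)

theorem compl_projectivization : A.projectivizationᶜ = projComp (Set.range A.form) := by
  ext p
  induction p using Projectivization.ind with
  | h v hv =>
    rw [mk_mem_projComp, Set.forall_mem_range]
    constructor
    · intro h i hi
      exact h ⟨v, hv, Set.mem_iUnion.2 ⟨i, hi⟩, rfl⟩
    · rintro h ⟨w, hw, hmem, heq⟩
      obtain ⟨i, hi⟩ := Set.mem_iUnion.1 hmem
      obtain ⟨a, ha⟩ := (Projectivization.mk_eq_mk_iff' ℂ _ _ _ _).1 heq
      have hi' : A.form i w = 0 := hi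
      exact h i (by rw [← ha, map_smul, hi', smul_zero])

theorem finrank_plane_inf {i j : Fin d} (hij : i ≠ j) :
    Module.finrank ℂ ↥(A.plane i ⊓ A.plane j) = 1 :=
  finrank_ker_inf_ker (A.form_ne_zero i) (A.form_ne_zero j) (A.ker_injective.ne hij)

theorem plane_inf_mem_oneFlats {i j : Fin d} (hij : i ≠ j) :
    A.plane i ⊓ A.plane j ∈ A.oneFlats :=
  ⟨A.finrank_plane_inf hij, {i, j}, (Finset.card_pair hij).ge, by
    rw [Finset.iInf_insert, Finset.iInf_singleton]⟩

theorem mem_image_plane_inf_iff {L : Submodule ℂ C3} (hL : L ∈ A.oneFlats) {a : Fin d}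
    {S : Finset (Fin d)} (ha : a ∉ S) :
    L ∈ (fun i => A.plane a ⊓ A.plane i) '' (S : Set (Fin d)) ↔
      L ≤ A.plane a ∧ ∃ i ∈ S, L ≤ A.plane i := by
  constructor
  · rintro ⟨i, hi, rfl⟩
    exact ⟨inf_le_left, i, hi, inf_le_right⟩
  · rintro ⟨hLa, i, hi, hLi⟩
    refine ⟨i, hi, (Submodule.eq_of_le_of_finrank_eq (le_inf hLa hLi) ?_).symm⟩
    rw [hL.1, A.finrank_plane_inf]
    rintro rfl
    exact ha hi

open Classical in
/-- The number of planes, among those indexed by `S`, which contain `L`. -/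
def multiplicityIn (S : Finset (Fin d)) (L : Submodule ℂ C3) : ℕ :=
  (S.filter fun i => L ≤ A.plane i).card

/-- The subtraction is truncated: flats of `A` lying in at most one plane of `S` contribute `0`, so
one fixed index set serves every subarrangement. Inserting `a` raises the term of `L` by one exactly
when `L` lies in `a` and in some plane of `S`, that is, when `L` is one of the intersections counted
on the right. -/
theorem sum_multiplicityIn_insert {a : Fin d} {S : Finset (Fin d)} (ha : a ∉ S) :
    ∑ L ∈ A.oneFlats_finite.toFinset, (A.multiplicityIn (insert a S) L - 1) =
      ∑ L ∈ A.oneFlats_finite.toFinset, (A.multiplicityIn S L - 1) +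
        ((fun i => A.plane a ⊓ A.plane i) '' (S : Set (Fin d))).ncard := by
  classical
  have hsub : (fun i => A.plane a ⊓ A.plane i) '' (S : Set (Fin d)) ⊆ A.oneFlats := by
    rintro _ ⟨i, hi, rfl⟩
    refine A.plane_inf_mem_oneFlats ?_
    rintro rfl
    exact ha hi
  have hcard : ((fun i => A.plane a ⊓ A.plane i) '' (S : Set (Fin d))).ncard =
      ∑ L ∈ A.oneFlats_finite.toFinset,
        if L ∈ (fun i => A.plane a ⊓ A.plane i) '' (S : Set (Fin d)) then 1 else 0 := by
    rw [← Finset.card_filter, ← Set.ncard_coe_finset]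
    congr 1
    ext L
    rw [Finset.mem_coe, Finset.mem_filter, Set.Finite.mem_toFinset]
    exact ⟨fun h => ⟨hsub h, h⟩, And.right⟩
  rw [hcard, ← Finset.sum_add_distrib]
  refine Finset.sum_congr rfl fun L hL => ?_
  rw [Set.Finite.mem_toFinset] at hL
  rw [if_congr (A.mem_image_plane_inf_iff hL ha) rfl rfl]
  unfold multiplicityIn
  rw [Finset.filter_insert]
  by_cases hLa : L ≤ A.plane a
  · rw [if_pos hLa, Finset.card_insert_of_notMem fun h => ha (Finset.mem_filter.1 h).1]
    by_cases hS : ∃ i ∈ S, L ≤ A.plane i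
    · have : 0 < (S.filter fun i => L ≤ A.plane i).card := by
        obtain ⟨i, hi, hLi⟩ := hS
        exact Finset.card_pos.2 ⟨i, Finset.mem_filter.2 ⟨hi, hLi⟩⟩
      rw [if_pos ⟨hLa, hS⟩]
      omega
    · have : (S.filter fun i => L ≤ A.plane i) = ∅ :=
        Finset.filter_eq_empty_iff.2 fun i hi hLi => hS ⟨i, hi, hLi⟩
      rw [if_neg fun h => hS h.2, this]
      rfl
  · rw [if_neg hLa, if_neg fun h => hLa h.1, add_zero]

theorem hasTopEulerChar_projComp_image (S : Finset (Fin d)) :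
    HasTopEulerChar ↥(projComp (A.form '' S))
      (3 - 2 * (S.card : ℤ) +
        (∑ L ∈ A.oneFlats_finite.toFinset, (A.multiplicityIn S L - 1) : ℕ)) := by
  classical
  induction S using Finset.induction_on with
  | empty =>
    rw [Finset.coe_empty, Set.image_empty]
    simpa [multiplicityIn] using hasTopEulerChar_projectivePlane
  | insert a S ha ih =>
    rw [A.sum_multiplicityIn_insert ha, Finset.coe_insert, Set.image_insert_eq,
      Finset.card_insert_of_notMem ha]
    -- The first plane is separate, because the deletion step requires a nonempty arrangement.
    obtain rfl | hS := S.eq_empty_or_nonempty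
    · rw [Finset.coe_empty, Set.image_empty, insert_empty_eq]
      simpa [multiplicityIn] using hasTopEulerChar_projComp_singleton (A.form_ne_zero a)
    · have := ih.projComp_insert (S.finite_toSet.image _) (hS.to_set.image _)
        (A.form_ne_zero a) (by
          rintro _ ⟨i, hi, rfl⟩
          refine ⟨A.form_ne_zero i, fun h => ha ?_⟩
          rwa [← A.ker_injective h])
      rw [Set.image_image] at this
      convert this using 1
      push_cast
      simp only [plane]
      ring

/-- This makes the truncated subtraction of the induction agree with integer subtraction for the
full arrangement. -/
theorem two_le_multiplicity {L : Submodule ℂ C3} (hL : L ∈ A.oneFlats) :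
    2 ≤ A.multiplicity L := by
  classical
  obtain ⟨-, S, hS, rfl⟩ := hL
  rw [multiplicity, Nat.card_eq_fintype_card, Fintype.card_subtype]
  refine hS.trans (Finset.card_le_card fun i hi => Finset.mem_filter.2 ⟨Finset.mem_univ i, ?_⟩)
  exact iInf₂_le i hi

theorem hasTopEulerChar_projComplement :
    HasTopEulerChar A.ProjComplement
      (3 - 2 * (d : ℤ) + ∑ L ∈ A.oneFlats_finite.toFinset, ((A.multiplicity L : ℤ) - 1)) := by
  have h := A.hasTopEulerChar_projComp_image Finset.univ
  rw [Finset.coe_univ, Set.image_univ, ← A.compl_projectivization, Finset.card_univ,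
    Fintype.card_fin] at h
  convert h using 2
  rw [Nat.cast_sum]
  refine Finset.sum_congr rfl fun L hL => ?_
  have h2 := A.two_le_multiplicity ((Set.Finite.mem_toFinset _).1 hL)
  have : A.multiplicityIn Finset.univ L = A.multiplicity L := by
    classical
    rw [multiplicity, Nat.card_eq_fintype_card, Fintype.card_subtype]
    unfold multiplicityIn
    congr
  rw [this]
  omega

end CentralArrangement

/-! ### The Milnor fiber as a covering space -/

section Covering

open Topology

namespace CentralArrangement

variable {d : ℕ} (A : CentralArrangement d)

theorem definingFunction_smul (t : ℂ) (v : C3) :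
    A.definingFunction (t • v) = t ^ d * A.definingFunction v := by
  simp [definingFunction, Finset.prod_mul_distrib]

theorem continuous_definingFunction : Continuous A.definingFunction :=
  continuous_finsetProd _ fun i _ => (A.form i).continuous_of_finiteDimensional

/-- The roots of unity act on the Milnor fiber by scalar multiplication. -/
instance milnorFiberAction : MulAction (rootsOfUnity d ℂ) A.MilnorFiber where
  smul ζ x := ⟨((ζ : ℂˣ) : ℂ) • x.1, by
    rw [A.definingFunction_smul, x.2, mul_one, ← Units.val_pow_eq_pow_val,
      (mem_rootsOfUnity d _).1 ζ.2, Units.val_one]⟩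
  one_smul x := Subtype.ext (one_smul ℂ x.1)
  mul_smul ζ ξ x := Subtype.ext (mul_smul ((ζ : ℂˣ) : ℂ) ((ξ : ℂˣ) : ℂ) x.1)

theorem continuous_milnorProjection (hd : 0 < d) : Continuous (A.milnorProjection hd) :=
  (isQuotientMap_mk.continuous.comp
    (f := fun x : A.MilnorFiber => (⟨x.1, A.ne_zero_of_mem hd x⟩ : {v : C3 // v ≠ 0}))
    (by fun_prop)).subtype_mk _

theorem isOpen_compl_projectivization : IsOpen A.projectivizationᶜ := by
  rw [A.compl_projectivization]
  exact isOpen_projComp (Set.finite_range _)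

theorem definingFunction_ne_zero {v : C3} (hv : v ≠ 0)
    (hmem : Projectivization.mk ℂ v hv ∈ A.projectivizationᶜ) : A.definingFunction v ≠ 0 := by
  rw [A.compl_projectivization, mk_mem_projComp, Set.forall_mem_range] at hmem
  exact Finset.prod_ne_zero_iff.2 fun i _ => hmem i

/-- Near any `v₀` off the arrangement, the projection to the projective complement factors through
the Milnor fiber. -/
theorem exists_local_lift (hd : 0 < d)
    (v₀ : ↥((fun v : {v : C3 // v ≠ 0} => Projectivization.mk ℂ v.1 v.2) ⁻¹'
      A.projectivizationᶜ)) :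
    ∃ φ : ↥((fun v : {v : C3 // v ≠ 0} => Projectivization.mk ℂ v.1 v.2) ⁻¹'
        A.projectivizationᶜ) → A.MilnorFiber, ContinuousAt φ v₀ ∧
      ∀ v, A.milnorProjection hd (φ v) = ⟨Projectivization.mk ℂ v.1.1 v.1.2, v.2⟩ := by
  have hQ := fun v : ↥((fun v : {v : C3 // v ≠ 0} => Projectivization.mk ℂ v.1 v.2) ⁻¹'
    A.projectivizationᶜ) => A.definingFunction_ne_zero v.1.2 v.2
  -- Rescaling by `t₀` brings the value of the defining function at `v₀` to `1`, where the principal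
  -- `d`-th root is continuous.
  obtain ⟨t₀, ht₀⟩ := IsAlgClosed.exists_pow_nat_eq (A.definingFunction v₀.1.1)⁻¹ hd
  have ht₀' : t₀ ≠ 0 := by
    rintro rfl
    rw [zero_pow hd.ne'] at ht₀
    exact inv_ne_zero (hQ v₀) ht₀.symm
  let s : ↥((fun v : {v : C3 // v ≠ 0} => Projectivization.mk ℂ v.1 v.2) ⁻¹'
      A.projectivizationᶜ) → ℂ := fun v => ((A.definingFunction (t₀ • v.1.1))⁻¹) ^ ((d : ℂ)⁻¹)
  have hQt : ∀ v : ↥((fun v : {v : C3 // v ≠ 0} => Projectivization.mk ℂ v.1 v.2) ⁻¹'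
      A.projectivizationᶜ), A.definingFunction (t₀ • v.1.1) ≠ 0 := fun v => by
    rw [A.definingFunction_smul]
    exact mul_ne_zero (pow_ne_zero _ ht₀') (hQ v)
  have hs : ∀ v, s v ^ d = (A.definingFunction (t₀ • v.1.1))⁻¹ := fun v =>
    Complex.cpow_nat_inv_pow _ hd.ne'
  have hmem : ∀ v, A.definingFunction (s v • t₀ • v.1.1) = 1 := fun v => by
    rw [A.definingFunction_smul, hs, inv_mul_cancel₀ (hQt v)]
  refine ⟨fun v => ⟨s v • t₀ • v.1.1, hmem v⟩, ?_, fun v => Subtype.ext ?_⟩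
  · refine IsEmbedding.subtypeVal.continuousAt_iff.2 ?_
    have hone : A.definingFunction (t₀ • v₀.1.1) = 1 := by
      rw [A.definingFunction_smul, ht₀, inv_mul_cancel₀ (hQ v₀)]
    have hval : Continuous fun v : ↥((fun v : {v : C3 // v ≠ 0} =>
        Projectivization.mk ℂ v.1 v.2) ⁻¹' A.projectivizationᶜ) => t₀ • v.1.1 := by fun_prop
    have hinv : ContinuousAt (fun v : ↥((fun v : {v : C3 // v ≠ 0} =>
        Projectivization.mk ℂ v.1 v.2) ⁻¹' A.projectivizationᶜ) =>
        (A.definingFunction (t₀ • v.1.1))⁻¹) v₀ :=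
      (A.continuous_definingFunction.comp hval).continuousAt.inv₀ (hQt v₀)
    exact (hinv.cpow continuousAt_const (by
      rw [hone, inv_one]
      exact Complex.one_mem_slitPlane)).smul hval.continuousAt
  · refine (Projectivization.mk_eq_mk_iff' ℂ _ _ _ _).2 ⟨s v * t₀, ?_⟩
    exact mul_smul _ _ _

/-- Openness downstairs is tested on vectors, one point at a time. At each point a lift through the
Milnor fiber that is continuous just there carries over the neighbourhood. -/
theorem isQuotientMap_milnorProjection (hd : 0 < d) : IsQuotientMap (A.milnorProjection hd) := by
  have hq := isQuotientMap_mk.restrictPreimage_isOpen A.isOpen_compl_projectivization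
  refine ⟨isCoinducing_iff.2 fun s => ⟨fun hs => ?_, fun hs =>
    hs.preimage (A.continuous_milnorProjection hd)⟩, fun p => ?_⟩
  rotate_left
  · obtain ⟨v, rfl⟩ := hq.surjective p
    obtain ⟨φ, -, hφ⟩ := A.exists_local_lift hd v
    exact ⟨φ v, hφ v⟩
  · rw [← hq.isOpen_preimage, isOpen_iff_mem_nhds]
    intro v hv
    obtain ⟨φ, hc, hφ⟩ := A.exists_local_lift hd v
    have hv' : A.milnorProjection hd (φ v) ∈ s := by
      rw [hφ]
      exact hv
    filter_upwards [hc (hs.mem_nhds hv')] with w hw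
    have : A.milnorProjection hd (φ w) ∈ s := hw
    rwa [hφ] at this

/-- A finite group acts freely on a closed subset of `ℂ³`, which is locally compact. The fibers are
the orbits: if `v` and `a • v` both lie in the Milnor fiber, homogeneity of degree `d` forces `a ^ d
= 1`. -/
theorem isQuotientCoveringMap_milnorProjection (hd : 0 < d) :
    IsQuotientCoveringMap (A.milnorProjection hd) (rootsOfUnity d ℂ) := by
  have : NeZero d := ⟨hd.ne'⟩
  have : ContinuousConstSMul (rootsOfUnity d ℂ) A.MilnorFiber :=
    ⟨fun ζ => Continuous.subtype_mk (continuous_subtype_val.const_smul ((ζ : ℂˣ) : ℂ)) _⟩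
  have : IsClosed {v : C3 | A.definingFunction v = 1} :=
    isClosed_singleton.preimage A.continuous_definingFunction
  have : LocallyCompactSpace A.MilnorFiber := this.isClosedEmbedding_subtypeVal.locallyCompactSpace
  have : IsCancelSMul (rootsOfUnity d ℂ) A.MilnorFiber := ⟨fun ζ ξ x h =>
    Subtype.ext (Units.ext (smul_left_injective ℂ (A.ne_zero_of_mem hd x)
      (congrArg Subtype.val h)))⟩
  refine (A.isQuotientMap_milnorProjection hd).isQuotientCoveringMap_of_properlyDiscontinuousSMul
    fun {x y} => ?_
  rw [Subtype.ext_iff]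
  refine (Projectivization.mk_eq_mk_iff ℂ _ _ _ _).trans ⟨?_, ?_⟩
  · rintro ⟨a, ha⟩
    refine ⟨⟨a, (mem_rootsOfUnity d a).2 (Units.ext ?_)⟩, Subtype.ext ha⟩
    have := A.definingFunction_smul a y.1
    rw [y.2, mul_one, ← Units.smul_def, ha, x.2] at this
    rw [Units.val_pow_eq_pow_val, ← this, Units.val_one]
  · rintro ⟨ζ, rfl⟩
    exact ⟨ζ, rfl⟩

theorem card_fiber_milnorProjection (hd : 0 < d) (u : A.ProjComplement) :
    Nat.card (A.milnorProjection hd ⁻¹' {u}) = d := by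
  have : NeZero d := ⟨hd.ne'⟩
  obtain ⟨x, hx⟩ := (A.isQuotientMap_milnorProjection hd).surjective u
  rw [Nat.card_congr ((A.isQuotientCoveringMap_milnorProjection hd).fiberEquivGroup ⟨x, hx⟩),
    Complex.card_rootsOfUnity]

end CentralArrangement

end Covering

/-! ### Multiplicativity for the Milnor fiber and the conclusion -/

section Main

/-- Translating the affine hyperplane `ℓ = 1` to the linear hyperplane `ℓ = 0`. -/
def kerHomeomorph {ℓ : Module.Dual ℂ C3} {v₀ : C3} (h : ℓ v₀ = 1) :
    LinearMap.ker ℓ ≃ₜ {v : C3 // ℓ v = 1} where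
  toFun w := ⟨v₀ + w.1, by rw [map_add, h, LinearMap.mem_ker.1 w.2, add_zero]⟩
  invFun v := ⟨v.1 - v₀, by rw [LinearMap.mem_ker, map_sub, h, v.2, sub_self]⟩
  left_inv w := Subtype.ext (add_sub_cancel_left _ _)
  right_inv v := Subtype.ext (add_sub_cancel _ _)

namespace CentralArrangement

variable {d : ℕ} (A : CentralArrangement d)

/-- The product formula needs its base inside a real vector space. Setting one form equal to `1` and
translating to its kernel presents the projective complement as the complement of an affine
arrangement. -/
theorem hasTopEulerChar_milnorFiber (hd : 0 < d) {χ : ℤ}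
    (hχ : HasTopEulerChar A.ProjComplement χ) : HasTopEulerChar A.MilnorFiber (d * χ) := by
  let i₀ : Fin d := ⟨0, hd⟩
  obtain ⟨v₀, hv₀⟩ : ∃ v, A.form i₀ v = 1 := by
    obtain ⟨v, hv⟩ := DFunLike.ne_iff.1 (A.form_ne_zero i₀)
    exact ⟨(A.form i₀ v)⁻¹ • v, by rw [map_smul, smul_eq_mul, inv_mul_cancel₀ hv]⟩
  let f : Fin d → LinearMap.ker (A.form i₀) → ℂ := fun i w => A.form i (v₀ + w.1)
  have hf : ∀ i, IsContAffine (f i) := fun i => by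
    refine ⟨(A.form i).continuous_of_finiteDimensional.comp (by fun_prop),
      fun x y a b hab => ?_⟩
    -- The translation by `v₀` is absorbed because `a + b = 1`.
    have hv : v₀ + (a • x + b • y).1 = (a : ℂ) • (v₀ + x.1) + (b : ℂ) • (v₀ + y.1) := by
      have : (b : ℂ) = 1 - a := by
        rw [← Complex.ofReal_one, ← Complex.ofReal_sub, ← hab, add_sub_cancel_left]
      change v₀ + ((a : ℂ) • x.1 + (b : ℂ) • y.1) = _
      rw [this]
      module
    change A.form i (v₀ + (a • x + b • y).1) = _
    rw [hv, map_add, map_smul, map_smul, smul_eq_mul, smul_eq_mul]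
  have e : A.ProjComplement ≃ₜ ↥{w | ∀ i, f i w ≠ 0} := by
    refine Homeomorph.symm (Homeomorph.trans ?_
      ((projCompChart (Set.finite_range A.form) ⟨i₀, rfl⟩).trans
        (Homeomorph.setCongr A.compl_projectivization.symm)))
    refine (kerHomeomorph hv₀).subtype fun w => ?_
    rw [Set.forall_mem_range]
    rfl
  have hcard : ∀ b, Nat.card (e ∘ A.milnorProjection hd ⁻¹' {b}) = d := fun b => by
    have : e ∘ A.milnorProjection hd ⁻¹' {b} = A.milnorProjection hd ⁻¹' {e.symm b} := by
      ext x
      simp [Homeomorph.eq_symm_apply]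
    rw [this, A.card_fiber_milnorProjection]
  exact hasTopEulerChar_covering_affineComplement hf
    ((A.isQuotientCoveringMap_milnorProjection hd).isCoveringMap.homeomorph_comp e)
    (fun b => Nat.finite_of_card_ne_zero (by rw [hcard]; exact hd.ne')) hcard
    (hχ.of_homeomorph e)

end CentralArrangement

theorem proposition2p1 (d : ℕ) (A : CentralArrangement d) :
    (HasFiniteTotalHomology A.ProjComplement ∧
      eulerCharacteristic A.ProjComplement =
        3 - 2 * (d : ℤ) + ∑ L ∈ A.oneFlats_finite.toFinset, ((A.multiplicity L : ℤ) - 1)) ∧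
    ∀ hd : 0 < d,
      (IsCoveringMap (A.milnorProjection hd) ∧
        ∀ u : A.ProjComplement, Nat.card (A.milnorProjection hd ⁻¹' {u}) = d) ∧
      HasFiniteTotalHomology A.MilnorFiber ∧
      eulerCharacteristic A.MilnorFiber = (d : ℤ) * eulerCharacteristic A.ProjComplement ∧
      eulerCharacteristic A.MilnorFiber =
        (d : ℤ) *
          (3 - 2 * (d : ℤ) + ∑ L ∈ A.oneFlats_finite.toFinset, ((A.multiplicity L : ℤ) - 1)) := by
  have hM := A.hasTopEulerChar_projComplement
  refine ⟨⟨hM.hasFiniteTotalHomology, hM.eulerCharacteristic_eq⟩, fun hd => ?_⟩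
  have hF := A.hasTopEulerChar_milnorFiber hd hM
  refine ⟨⟨(A.isQuotientCoveringMap_milnorProjection hd).isCoveringMap,
    A.card_fiber_milnorProjection hd⟩, hF.hasFiniteTotalHomology, ?_, hF.eulerCharacteristic_eq⟩
  rw [hF.eulerCharacteristic_eq, hM.eulerCharacteristic_eq]

end Main

end
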